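/- A system consists of $n\ge 2$ identical elements; at each moment one element works and the other operable ones are in cold reserve. When the working element breaks down, it is immediately replaced by an operable one. Broken elements are repaired, one at a time in order of breakdown, by a single perfectly reliable repair device. The working times are i.i.d. with distribution $G$ on $[0,\infty)$, whose distribution function is continuous on $\mathbb R$ (in particular $G(0)=0$) and whose mean $b=\int_0^\infty t\,dG(t)$ is finite; the repair times are i.i.d. exponential with rate $\mu>0$; all these random variables are mutually independent. For $j\in\{0,1,\dots,n-1\}$ let $\tau_j$ be the lifetime of the system that starts at time $0$ with $j$ broken elements (the operating element beginning its working time and, if $j\ge1$, the device beginning a repair), that is, the first moment at which all $n$ elements are broken. Let $\varepsilon(\mu)=\int_0^\infty e^{-\mu t}\,dG(t)$. Then for every $j\in\{0,\dots,n-1\}$ the time $\tau_j$ is almost surely finite for every $\mu>0$; for every $t\ge 0$, $$P\bigl(\varepsilon(\mu)^{n-1}\tau_j>t\bigr)\to e^{-t/b}\qquad(\mu\to\infty);$$ and, with $\varphi_j(s)=E\,e^{-s\tau_j}$ (which depends on $\mu$), for every $s\ge 0$, $$\varphi_j\bigl(\varepsilon(\mu)^{n-1}s\bigr)\to\frac1{1+bs}\qquad(\mu\to\infty).$$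 -/

import Mathlib

open MeasureTheory ProbabilityTheory Filter Topology

namespace ColdReserve

/-- `failureTime x m` is the instant of the `m`-th breakdown when the successive working times are
`x 0, x 1, …`: until the system fails, a broken element is replaced at once by an operable one, so
the working times simply follow one another. -/
def failureTime (x : ℕ → ℝ) (m : ℕ) : ℝ := ∑ i ∈ Finset.range m, x i

/-- The instant at which the `k`-th broken element (counted from `0`) joins the repair queue, when
`j` elements are already broken at time `0`: the first `j` are there from the beginning, and the
following ones arrive at the successive breakdowns. -/
def arrivalTime (j : ℕ) (x : ℕ → ℝ) (k : ℕ) : ℝ :=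
  if k < j then 0 else failureTime x (k - j + 1)

/-- The instant at which the repair of the `k`-th broken element is completed. There is a single
repair device, serving the queue in order of arrival, and `y k` is the duration of the `k`-th
repair, which starts as soon as the element has arrived and the previous repair is over. -/
noncomputable def repairTime (j : ℕ) (x y : ℕ → ℝ) : ℕ → ℝ
  | 0 => arrivalTime j x 0 + y 0
  | k + 1 => max (arrivalTime j x (k + 1)) (repairTime j x y k) + y (k + 1)

/-- The number of elements that are broken immediately after the `m`-th breakdown: `j + m` elements
have entered the repair queue so far, and those whose repair is completed have left it. -/
noncomputable def brokenCount (j : ℕ) (x y : ℕ → ℝ) (m : ℕ) : ℕ :=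
  j + m - ((Finset.range (j + m)).filter fun k => repairTime j x y k ≤ failureTime x m).card

/-- The lifetime of the system with `n` elements, `j` of them broken at time `0`: the first
breakdown after which all `n` elements are broken (`⊤` if this never happens). -/
noncomputable def lifetime (n j : ℕ) (x y : ℕ → ℝ) : ENNReal :=
  ⨅ (m : ℕ) (_ : n ≤ brokenCount j x y m), ENNReal.ofReal (failureTime x m)

/-- `ε(μ) = ∫ exp (-μ t) dG(t)`. -/
noncomputable def eps (G : Measure ℝ) (μ : ℝ) : ℝ := ∫ t, Real.exp (-μ * t) ∂G

/-- The working times `η i` are distributed according to `G`, the repair times `ξ k` are exponential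
with rate `μ`, and all these random variables are mutually independent. -/
structure IsRepairModel {Ω : Type*} [MeasurableSpace Ω] (P : Measure Ω) (G : Measure ℝ) (μ : ℝ)
    (η ξ : ℕ → Ω → ℝ) : Prop where
  work_law : ∀ i, HasLaw (η i) G P
  repair_law : ∀ k, HasLaw (ξ k) (expMeasure μ) P
  indep : iIndepFun (Sum.elim η ξ) P

/-- The lifetime as a random variable. -/
noncomputable def systemLifetime {Ω : Type*} (n j : ℕ) (η ξ : ℕ → Ω → ℝ) (ω : Ω) : ENNReal :=
  lifetime n j (fun i => η i ω) (fun k => ξ k ω)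

/-- The Laplace–Stieltjes transform `s ↦ E exp (-s τ)` of an (almost surely finite) random time. -/
noncomputable def laplaceTransform {Ω : Type*} [MeasurableSpace Ω] (P : Measure Ω)
    (τ : Ω → ENNReal) (s : ℝ) : ℝ :=
  ∫ ω, Real.exp (-s * (τ ω).toReal) ∂P

end ColdReserve

/-!
Let `φ_j(s) = E exp (-s τ_j)` for complex `s` with `0 ≤ re s`, paths with `τ_j = ∞` contributing
nothing. At each breakdown, and at the end of each repair, the system starts afresh: the exponential
repair in progress forgets its past, and so only the number of broken elements and the remaining
working time matter (`lifetime_prepend_of_lt`, `lifetime_prepend_of_le`, `transformWork_succ`).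
Induction on the number of broken elements shows that the number of repairs ending during a working
time `u` is a Poisson variable of mean `μ u` stopped when the queue empties, so that the `φ_j` solve
the finite linear system (`transform_eq`)

  `φ_j = g φ_1 + ∑_{k < j} a_k (φ_{j+1-k} - φ_1)` for `j < n`,  `φ_n = 1`,

with `g(s) = ∫ exp (-s u) dG` and `a_k(s) = ∫ exp (-s u) exp (-μ u) (μ u) ^ k / k! dG`.

At `s = 0` the only solution is `φ_j = 1`, which says that `τ_j` is almost surely finite
(`transform_zero`). Now replace `s` by `ε ^ (n - 1) s`. As `μ → ∞`, `a_0 / ε → 1`, `a_k → 0` for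
`k ≥ 1`, and `(1 - g) / ε ^ (n - 1) → b s`. The equation for `φ_j` then gives
`φ_{j+1} - φ_1 ≈ b s ε ^ (n - 1 - j) φ_1` by induction on `j ≥ 1`, hence `1 - φ_1 ≈ b s φ_1`, hence
`φ_j → 1 / (1 + b s)` for all `j < n` (`tendsto_of_linear_system`, `tendsto_transform`). Real `s`
give the claim on Laplace transforms, and imaginary `s` the convergence of the characteristic
functions, hence, by Lévy's theorem, convergence in law.
-/

namespace ColdReserve

/-! ### Elementary properties of the repair queue -/

/-- The sequence with first term `u` followed by the terms of `x`. -/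
def prepend (u : ℝ) (x : ℕ → ℝ) : ℕ → ℝ
  | 0 => u
  | k + 1 => x k

@[simp] lemma prepend_zero (u : ℝ) (x : ℕ → ℝ) : prepend u x 0 = u := rfl

@[simp] lemma prepend_succ (u : ℝ) (x : ℕ → ℝ) (k : ℕ) : prepend u x (k + 1) = x k := rfl

lemma prepend_nonneg {u : ℝ} {x : ℕ → ℝ} (hu : 0 ≤ u) (hx : ∀ i, 0 ≤ x i) (k : ℕ) :
    0 ≤ prepend u x k := by
  cases k with
  | zero => exact hu
  | succ k => exact hx k

@[simp] lemma failureTime_zero (x : ℕ → ℝ) : failureTime x 0 = 0 := by simp [failureTime]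

lemma failureTime_nonneg {x : ℕ → ℝ} (hx : ∀ i, 0 ≤ x i) (m : ℕ) : 0 ≤ failureTime x m :=
  Finset.sum_nonneg fun i _ => hx i

lemma failureTime_prepend_succ (u : ℝ) (x : ℕ → ℝ) (m : ℕ) :
    failureTime (prepend u x) (m + 1) = u + failureTime x m := by
  simp [failureTime, Finset.sum_range_succ', add_comm]

lemma arrivalTime_nonneg {x : ℕ → ℝ} (hx : ∀ i, 0 ≤ x i) (j k : ℕ) : 0 ≤ arrivalTime j x k := by
  unfold arrivalTime
  split_ifs
  · exact le_rfl
  · exact failureTime_nonneg hx _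

lemma le_repairTime {x y : ℕ → ℝ} (hx : ∀ i, 0 ≤ x i) (hy : ∀ i, 0 ≤ y i) (j k : ℕ) :
    y 0 ≤ repairTime j x y k := by
  induction k with
  | zero => simpa [repairTime] using arrivalTime_nonneg hx j 0
  | succ k ih =>
    have := le_max_right (arrivalTime j x (k + 1)) (repairTime j x y k)
    have := hy (k + 1)
    simp only [repairTime]
    linarith

lemma repairTime_nonneg {x y : ℕ → ℝ} (hx : ∀ i, 0 ≤ x i) (hy : ∀ i, 0 ≤ y i) (j k : ℕ) :
    0 ≤ repairTime j x y k :=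
  (hy 0).trans (le_repairTime hx hy j k)

/-! ### Renewal of the system at a breakdown or at the end of a repair -/

lemma arrivalTime_zero_prepend (u : ℝ) (x : ℕ → ℝ) (k : ℕ) :
    arrivalTime 0 (prepend u x) k = u + arrivalTime 1 x k := by
  cases k with
  | zero => simp [arrivalTime, failureTime]
  | succ k => simp [arrivalTime, failureTime_prepend_succ]

lemma repairTime_zero_prepend (u : ℝ) (x y : ℕ → ℝ) (k : ℕ) :
    repairTime 0 (prepend u x) y k = u + repairTime 1 x y k := by
  induction k with
  | zero => simp only [repairTime, arrivalTime_zero_prepend]; ring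
  | succ k ih => simp only [repairTime, arrivalTime_zero_prepend, ih, max_add_add_left]; ring

lemma arrivalTime_succ_prepend (j : ℕ) (u : ℝ) (x : ℕ → ℝ) (k : ℕ) :
    arrivalTime (j + 1) (prepend u x) k =
      if k < j + 1 then 0 else u + arrivalTime (j + 2) x k := by
  unfold arrivalTime
  split_ifs with h1 h2
  · rfl
  · obtain rfl : k = j + 1 := by omega
    simp [failureTime]
  · rw [failureTime_prepend_succ, show k - (j + 1) = k - (j + 2) + 1 by omega]

/-- When the first repair outlasts the first working time `u`, the queue seen from the instant `u`
is that of a system started with one more broken element and the residual first repair. -/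
lemma repairTime_prepend_of_lt {j : ℕ} {u v : ℝ} {x y : ℕ → ℝ} (hu : 0 ≤ u)
    (huv : u < v) (hx : ∀ i, 0 ≤ x i) (hy : ∀ i, 0 ≤ y i) (k : ℕ) :
    repairTime (j + 1) (prepend u x) (prepend v y) k =
      u + repairTime (j + 2) x (prepend (v - u) y) k := by
  have hy' := prepend_nonneg (sub_nonneg.2 huv.le) hy
  induction k with
  | zero => simp [repairTime, arrivalTime]
  | succ k ih =>
    simp only [repairTime, arrivalTime_succ_prepend, ih, prepend_succ]
    split_ifs with h
    · have h0 : arrivalTime (j + 2) x (k + 1) = 0 := by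
        simp [arrivalTime, show k + 1 < j + 2 by omega]
      have hR := repairTime_nonneg hx hy' (j + 2) k
      rw [h0, max_eq_right hR, max_eq_right (by linarith)]
      ring
    · rw [max_add_add_left]; ring

/-- When the first repair ends, at time `v`, before the first breakdown, the queue seen from the
instant `v` is that of a system started with one broken element less and the residual working
time. -/
lemma repairTime_prepend_of_le {j : ℕ} {u v : ℝ} {x y : ℕ → ℝ} (hv : 0 ≤ v)
    (hvu : v ≤ u) (hx : ∀ i, 0 ≤ x i) (hy : ∀ i, 0 ≤ y i) (k : ℕ) :
    repairTime (j + 1) (prepend u x) (prepend v y) (k + 1) =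
      v + repairTime j (prepend (u - v) x) y k := by
  have hx' := prepend_nonneg (sub_nonneg.2 hvu) hx
  have harr : ∀ k, arrivalTime (j + 1) (prepend u x) (k + 1) =
      if k < j then 0 else v + arrivalTime j (prepend (u - v) x) k := by
    intro k
    unfold arrivalTime
    simp only [add_lt_add_iff_right, Nat.add_sub_add_right, failureTime_prepend_succ]
    split_ifs
    · rfl
    · ring
  induction k with
  | zero =>
    simp only [repairTime, harr, prepend_succ, prepend_zero]
    have h0 : arrivalTime (j + 1) (prepend u x) 0 = 0 := by simp [arrivalTime]
    rw [h0]
    split_ifs with h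
    · have : arrivalTime j (prepend (u - v) x) 0 = 0 := by simp [arrivalTime, h]
      rw [this, max_eq_right (by linarith)]
      ring
    · have := arrivalTime_nonneg hx' j 0
      rw [max_eq_left (by linarith)]
      ring
  | succ k ih =>
    rw [repairTime, harr, ih, repairTime]
    simp only [prepend_succ]
    split_ifs with h
    · have : arrivalTime j (prepend (u - v) x) (k + 1) = 0 := by simp [arrivalTime, h]
      have hR := repairTime_nonneg hx' hy j k
      rw [this, max_eq_right hR, max_eq_right (by linarith)]
      ring
    · rw [max_add_add_left]; ring

lemma brokenCount_zero_le (j : ℕ) (x y : ℕ → ℝ) : brokenCount j x y 0 ≤ j := by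
  simp [brokenCount]

lemma brokenCount_succ_eq {j j' : ℕ} {u : ℝ} {x x' y y' : ℕ → ℝ} (m : ℕ) (hj : j' = j + 1)
    (hR : ∀ k, repairTime j (prepend u x) y k = u + repairTime j' x' y' k)
    (hF : failureTime x m = failureTime x' m) :
    brokenCount j (prepend u x) y (m + 1) = brokenCount j' x' y' m := by
  subst hj
  simp only [brokenCount, hR, failureTime_prepend_succ, add_le_add_iff_left, hF,
    show j + (m + 1) = j + 1 + m by ring]

lemma lifetime_eq_iInf_succ {n j : ℕ} (hj : j < n) (x y : ℕ → ℝ) :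
    lifetime n j x y = ⨅ (m : ℕ) (_ : n ≤ brokenCount j x y (m + 1)),
      ENNReal.ofReal (failureTime x (m + 1)) := by
  have h0 : ¬ n ≤ brokenCount j x y 0 := by
    have := brokenCount_zero_le j x y
    omega
  rw [lifetime, ← inf_iInf_nat_succ]
  simp [h0]

lemma ofReal_add_iInf₂ {p : ℕ → Prop} {f g : ℕ → ℝ} {c : ℝ} (hc : 0 ≤ c) (hg : ∀ m, 0 ≤ g m)
    (h : ∀ m, f m = c + g m) :
    ⨅ (m : ℕ) (_ : p m), ENNReal.ofReal (f m) =
      ENNReal.ofReal c + ⨅ (m : ℕ) (_ : p m), ENNReal.ofReal (g m) := by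
  rw [ENNReal.add_iInf]
  refine iInf_congr fun m => ?_
  by_cases hm : p m
  · simp [hm, h, ENNReal.ofReal_add hc (hg m)]
  · simp [hm]

/-- With no broken element nothing happens until the first breakdown. -/
lemma lifetime_zero_prepend {n : ℕ} (hn : 0 < n) {u : ℝ} {x : ℕ → ℝ} (y : ℕ → ℝ) (hu : 0 ≤ u)
    (hx : ∀ i, 0 ≤ x i) :
    lifetime n 0 (prepend u x) y = ENNReal.ofReal u + lifetime n 1 x y := by
  rw [lifetime_eq_iInf_succ hn, lifetime, ← ofReal_add_iInf₂ hu (failureTime_nonneg hx)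
    fun m => failureTime_prepend_succ u x m]
  simp only [brokenCount_succ_eq _ (zero_add 1).symm (repairTime_zero_prepend u x y) rfl]

/-- A breakdown at time `u` comes before the end of the repair in progress. -/
lemma lifetime_prepend_of_lt {n j : ℕ} (hj : j + 1 < n) {u v : ℝ} {x y : ℕ → ℝ} (hu : 0 ≤ u)
    (huv : u < v) (hx : ∀ i, 0 ≤ x i) (hy : ∀ i, 0 ≤ y i) :
    lifetime n (j + 1) (prepend u x) (prepend v y) =
      ENNReal.ofReal u + lifetime n (j + 2) x (prepend (v - u) y) := by
  rw [lifetime_eq_iInf_succ hj, lifetime, ← ofReal_add_iInf₂ hu (failureTime_nonneg hx)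
    fun m => failureTime_prepend_succ u x m]
  simp only [brokenCount_succ_eq _ rfl (repairTime_prepend_of_lt hu huv hx hy) rfl]

/-- The repair in progress ends, at time `v`, before the next breakdown. -/
lemma lifetime_prepend_of_le {n j : ℕ} (hj : j + 1 < n) {u v : ℝ} {x y : ℕ → ℝ} (hv : 0 ≤ v)
    (hvu : v ≤ u) (hx : ∀ i, 0 ≤ x i) (hy : ∀ i, 0 ≤ y i) :
    lifetime n (j + 1) (prepend u x) (prepend v y) =
      ENNReal.ofReal v + lifetime n j (prepend (u - v) x) y := by
  have hF : ∀ m, failureTime (prepend u x) (m + 1) =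
      v + failureTime (prepend (u - v) x) (m + 1) := fun m => by
    rw [failureTime_prepend_succ, failureTime_prepend_succ]; ring
  have hx' := prepend_nonneg (sub_nonneg.2 hvu) hx
  rw [lifetime_eq_iInf_succ hj, lifetime_eq_iInf_succ (by omega : j < n),
    ← ofReal_add_iInf₂ hv (fun m => failureTime_nonneg hx' _) hF]
  have hB : ∀ m, brokenCount (j + 1) (prepend u x) (prepend v y) (m + 1) =
      brokenCount j (prepend (u - v) x) y (m + 1) := fun m => by
    have h0 : repairTime (j + 1) (prepend u x) (prepend v y) 0 ≤
        v + failureTime (prepend (u - v) x) (m + 1) := by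
      simpa [repairTime, arrivalTime] using failureTime_nonneg hx' (m + 1)
    simp only [brokenCount, hF, Finset.card_filter]
    rw [show j + 1 + (m + 1) = j + (m + 1) + 1 by ring, Finset.sum_range_succ']
    simp only [repairTime_prepend_of_le hv hvu hx hy, add_le_add_iff_left, h0, if_true]
    omega
  simp only [hB]

lemma lifetime_self {n : ℕ} {x y : ℕ → ℝ} (hx : ∀ i, 0 ≤ x i) (hy : ∀ i, 0 ≤ y i)
    (hy0 : 0 < y 0) : lifetime n n x y = 0 := by
  have h : ∀ k, ¬ repairTime n x y k ≤ 0 := fun k =>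
    not_le.2 (hy0.trans_le (le_repairTime hx hy n k))
  refine le_antisymm (iInf₂_le_of_le 0 ?_ (by simp)) zero_le
  simp [brokenCount, h]

/-! ### The law of the working and repair times -/

lemma measurable_prepend : Measurable fun p : ℝ × (ℕ → ℝ) => prepend p.1 p.2 := by
  refine measurable_pi_iff.2 fun k => ?_
  cases k with
  | zero => exact measurable_fst
  | succ k => exact (measurable_pi_apply k).comp measurable_snd

/-- Prepending an independent term to an i.i.d. sequence gives an i.i.d. sequence. -/
lemma measurePreserving_prepend (ν : Measure ℝ) [IsProbabilityMeasure ν] :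
    MeasurePreserving (fun p : ℝ × (ℕ → ℝ) => prepend p.1 p.2)
      (ν.prod (Measure.infinitePi fun _ : ℕ => ν)) (Measure.infinitePi fun _ : ℕ => ν) := by
  refine ⟨measurable_prepend, Measure.eq_infinitePi _ fun s t ht => ?_⟩
  rw [Measure.map_apply measurable_prepend
    (MeasurableSet.pi s.countable_toSet fun i _ => ht i)]
  set s' : Finset ℕ := s.preimage Nat.succ Nat.succ_injective.injOn with hs'
  have hpre : (fun p : ℝ × (ℕ → ℝ) => prepend p.1 p.2) ⁻¹' (Set.pi s t) =
      (if 0 ∈ s then t 0 else Set.univ) ×ˢ Set.pi s' (fun i => t (i + 1)) := by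
    ext ⟨u, x⟩
    simp only [Set.mem_preimage, Set.mem_pi, Finset.mem_coe, Set.mem_prod, hs',
      Finset.mem_preimage, Nat.succ_eq_add_one]
    constructor
    · intro h
      refine ⟨?_, fun i hi => h _ hi⟩
      split_ifs with h0
      · exact h 0 h0
      · trivial
    · rintro ⟨h0, h1⟩ (_ | i) hi
      · simpa [hi] using h0
      · exact h1 i hi
  rw [hpre, Measure.prod_prod, Measure.infinitePi_pi _ fun i _ => ht (i + 1)]
  have hprod : ∏ i ∈ s', ν (t (i + 1)) = ∏ i ∈ s.erase 0, ν (t i) := by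
    refine Finset.prod_bij (fun i _ => i + 1) ?_ ?_ ?_ ?_
    · intro i hi
      simpa [hs'] using hi
    · intro i _ k _ h
      simpa using h
    · intro i hi
      obtain ⟨hi0, his⟩ := Finset.mem_erase.1 hi
      exact ⟨i - 1, by simpa [hs', Nat.sub_add_cancel (Nat.pos_of_ne_zero hi0)] using his,
        Nat.sub_add_cancel (Nat.pos_of_ne_zero hi0)⟩
    · intro i _
      rfl
  rw [hprod]
  split_ifs with h0
  · exact Finset.mul_prod_erase s (fun i => ν (t i)) h0
  · rw [Finset.erase_eq_of_notMem h0, measure_univ, one_mul]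

/-- The joint law of the working times, with law `G`, and of the repair times, with law `ν`. -/
noncomputable def pathLaw (G ν : Measure ℝ) : Measure ((ℕ → ℝ) × (ℕ → ℝ)) :=
  (Measure.infinitePi fun _ : ℕ => G).prod (Measure.infinitePi fun _ : ℕ => ν)

instance (G ν : Measure ℝ) [IsProbabilityMeasure G] [IsProbabilityMeasure ν] :
    IsProbabilityMeasure (pathLaw G ν) := by
  unfold pathLaw; infer_instance

lemma measurePreserving_prepend_fst (G ν : Measure ℝ) [IsProbabilityMeasure G]
    [IsProbabilityMeasure ν] :
    MeasurePreserving (fun q : ℝ × ((ℕ → ℝ) × (ℕ → ℝ)) => (prepend q.1 q.2.1, q.2.2))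
      (G.prod (pathLaw G ν)) (pathLaw G ν) :=
  ((measurePreserving_prepend G).prod (MeasurePreserving.id _)).comp
    ((measurePreserving_prodAssoc G (Measure.infinitePi fun _ : ℕ => G)
      (Measure.infinitePi fun _ : ℕ => ν)).symm MeasurableEquiv.prodAssoc)

lemma measurePreserving_prepend_snd (G ν : Measure ℝ) [IsProbabilityMeasure G]
    [IsProbabilityMeasure ν] :
    MeasurePreserving (fun q : ℝ × ((ℕ → ℝ) × (ℕ → ℝ)) => (q.2.1, prepend q.1 q.2.2))
      (ν.prod (pathLaw G ν)) (pathLaw G ν) := by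
  have h1 : MeasurePreserving (Prod.swap : ℝ × ((ℕ → ℝ) × (ℕ → ℝ)) → _)
      (ν.prod (pathLaw G ν)) ((pathLaw G ν).prod ν) := Measure.measurePreserving_swap
  have h2 := measurePreserving_prodAssoc (Measure.infinitePi fun _ : ℕ => G)
      (Measure.infinitePi fun _ : ℕ => ν) ν
  have h3 : MeasurePreserving (Prod.swap : (ℕ → ℝ) × ℝ → _)
      ((Measure.infinitePi fun _ : ℕ => ν).prod ν) (ν.prod (Measure.infinitePi fun _ : ℕ => ν)) :=
    Measure.measurePreserving_swap
  exact ((MeasurePreserving.id _).prod ((measurePreserving_prepend ν).comp h3)).comp (h2.comp h1)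

lemma ae_infinitePi_of_ae {ν : Measure ℝ} [IsProbabilityMeasure ν] {p : ℝ → Prop}
    (h : ∀ᵐ t ∂ν, p t) : ∀ᵐ x ∂(Measure.infinitePi fun _ : ℕ => ν), ∀ i, p (x i) :=
  ae_all_iff.2 fun i =>
    (measurePreserving_eval_infinitePi (fun _ : ℕ => ν) i).quasiMeasurePreserving.ae h

lemma ae_pathLaw_of_ae {G ν : Measure ℝ} [IsProbabilityMeasure G] [IsProbabilityMeasure ν]
    {p q : ℝ → Prop} (hp : ∀ᵐ t ∂G, p t) (hq : ∀ᵐ t ∂ν, q t) :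
    ∀ᵐ z ∂(pathLaw G ν), (∀ i, p (z.1 i)) ∧ ∀ i, q (z.2 i) := by
  have h1 := Measure.quasiMeasurePreserving_fst (μ := Measure.infinitePi fun _ : ℕ => G)
    (ν := Measure.infinitePi fun _ : ℕ => ν) |>.ae (ae_infinitePi_of_ae hp)
  have h2 := Measure.quasiMeasurePreserving_snd (μ := Measure.infinitePi fun _ : ℕ => G)
    (ν := Measure.infinitePi fun _ : ℕ => ν) |>.ae (ae_infinitePi_of_ae hq)
  exact h1.and h2

lemma measurable_sumElim :
    Measurable fun z : (ℕ → ℝ) × (ℕ → ℝ) => (Sum.elim z.1 z.2 : ℕ ⊕ ℕ → ℝ) := by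
  refine measurable_pi_iff.2 fun k => ?_
  rcases k with k | k
  · exact (measurable_pi_apply k).comp measurable_fst
  · exact (measurable_pi_apply k).comp measurable_snd

lemma map_sumElim_pathLaw (G ν : Measure ℝ) [IsProbabilityMeasure G] [IsProbabilityMeasure ν] :
    (pathLaw G ν).map (fun z => (Sum.elim z.1 z.2 : ℕ ⊕ ℕ → ℝ)) =
      Measure.infinitePi (Sum.elim (fun _ => G) (fun _ => ν) : ℕ ⊕ ℕ → Measure ℝ) := by
  have hi : ∀ k, IsProbabilityMeasure
      ((Sum.elim (fun _ => G) (fun _ => ν) : ℕ ⊕ ℕ → Measure ℝ) k) := by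
    rintro (k | k)
    · simpa
    · simpa
  refine Measure.eq_infinitePi _ fun s t ht => ?_
  rw [Measure.map_apply measurable_sumElim (MeasurableSet.pi s.countable_toSet fun i _ => ht i)]
  have hpre : (fun z : (ℕ → ℝ) × (ℕ → ℝ) => (Sum.elim z.1 z.2 : ℕ ⊕ ℕ → ℝ)) ⁻¹' (Set.pi s t) =
      Set.pi s.toLeft (fun i => t (.inl i)) ×ˢ Set.pi s.toRight (fun i => t (.inr i)) := by
    ext ⟨x, y⟩
    simp [Set.mem_pi]
  rw [hpre, pathLaw, Measure.prod_prod, Measure.infinitePi_pi _ fun i _ => ht _,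
    Measure.infinitePi_pi _ fun i _ => ht _, Finset.prod_sum_eq_prod_toLeft_mul_prod_toRight]
  simp

lemma IsRepairModel.hasLaw_pathLaw {Ω : Type*} [MeasurableSpace Ω] {P : Measure Ω}
    {G : Measure ℝ} [IsProbabilityMeasure G] {μ : ℝ} (hμ : 0 < μ) {η ξ : ℕ → Ω → ℝ}
    (h : IsRepairModel P G μ η ξ) :
    HasLaw (fun ω => ((fun i => η i ω), fun k => ξ k ω)) (pathLaw G (expMeasure μ)) P := by
  have := isProbabilityMeasure_expMeasure hμ
  have hη : AEMeasurable (fun ω i => η i ω) P :=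
    aemeasurable_pi_iff.2 fun i => (h.work_law i).aemeasurable
  have hξ : AEMeasurable (fun ω k => ξ k ω) P :=
    aemeasurable_pi_iff.2 fun k => (h.repair_law k).aemeasurable
  refine ⟨hη.prodMk hξ, ?_⟩
  have hsum : AEMeasurable (fun ω k => Sum.elim η ξ k ω) P := aemeasurable_pi_iff.2 <| by
    rintro (k | k)
    · exact (h.work_law k).aemeasurable
    · exact (h.repair_law k).aemeasurable
  have hi : ∀ k, IsProbabilityMeasure
      ((Sum.elim (fun _ => G) (fun _ => expMeasure μ) : ℕ ⊕ ℕ → Measure ℝ) k) := by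
    rintro (k | k)
    · simpa
    · simpa
  have hlaw := (h.indep.hasLaw_infinitePi
    (μ := (Sum.elim (fun _ => G) (fun _ => expMeasure μ) : ℕ ⊕ ℕ → Measure ℝ))
    (by rintro (k | k); exacts [h.work_law k, h.repair_law k]) hsum).map_eq
  have hsplit : Measurable fun z : ℕ ⊕ ℕ → ℝ => ((fun i => z (.inl i)), fun k => z (.inr k)) := by
    fun_prop
  rw [← map_sumElim_pathLaw] at hlaw
  have hlaw' := congrArg (Measure.map fun z : ℕ ⊕ ℕ → ℝ =>
    ((fun i => z (.inl i)), fun k => z (.inr k))) hlaw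
  rw [AEMeasurable.map_map_of_aemeasurable hsplit.aemeasurable hsum,
    Measure.map_map hsplit measurable_sumElim] at hlaw'
  simpa [Function.comp_def] using hlaw'

/-! ### Measurability of the lifetime -/

lemma measurable_failureTime (m : ℕ) : Measurable fun x : ℕ → ℝ => failureTime x m := by
  unfold failureTime; fun_prop

lemma measurable_arrivalTime (j k : ℕ) : Measurable fun x : ℕ → ℝ => arrivalTime j x k := by
  unfold arrivalTime
  split_ifs
  · exact measurable_const
  · exact measurable_failureTime _

lemma measurable_repairTime (j k : ℕ) :
    Measurable fun z : (ℕ → ℝ) × (ℕ → ℝ) => repairTime j z.1 z.2 k := by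
  have ha : ∀ k, Measurable fun z : (ℕ → ℝ) × (ℕ → ℝ) => arrivalTime j z.1 k :=
    fun k => (measurable_arrivalTime j k).comp measurable_fst
  have hy : ∀ k, Measurable fun z : (ℕ → ℝ) × (ℕ → ℝ) => z.2 k := fun k => by fun_prop
  induction k with
  | zero => exact (ha 0).add (hy 0)
  | succ k ih => exact ((ha (k + 1)).max ih).add (hy (k + 1))

lemma measurable_brokenCount (j m : ℕ) :
    Measurable fun z : (ℕ → ℝ) × (ℕ → ℝ) => brokenCount j z.1 z.2 m := by
  unfold brokenCount
  simp only [Finset.card_filter]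
  refine measurable_const.sub (Finset.measurable_fun_sum _ fun k _ => ?_)
  exact Measurable.ite (measurableSet_le (measurable_repairTime j k)
    ((measurable_failureTime m).comp measurable_fst)) measurable_const measurable_const

lemma measurable_lifetime (n j : ℕ) :
    Measurable fun z : (ℕ → ℝ) × (ℕ → ℝ) => lifetime n j z.1 z.2 := by
  unfold lifetime
  refine Measurable.iInf fun m => ?_
  classical
  have hs : MeasurableSet {z : (ℕ → ℝ) × (ℕ → ℝ) | n ≤ brokenCount j z.1 z.2 m} :=
    measurableSet_le measurable_const (measurable_brokenCount j m)
  have h : Measurable fun z : (ℕ → ℝ) × (ℕ → ℝ) =>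
      if n ≤ brokenCount j z.1 z.2 m then ENNReal.ofReal (failureTime z.1 m) else ⊤ :=
    Measurable.ite hs ((measurable_failureTime m).comp measurable_fst).ennreal_ofReal
      measurable_const
  convert h using 2 with z
  by_cases hz : n ≤ brokenCount j z.1 z.2 m <;> simp [hz]

/-! ### Laplace transforms of the lifetime -/

section Transform

/-- The discount factor `exp (-s τ)`, for a complex parameter `s`, with value `0` at `τ = ⊤`. -/
noncomputable def discount (s : ℂ) (τ : ENNReal) : ℂ :=
  if τ = ⊤ then 0 else Complex.exp (-s * (τ.toReal : ℂ))

@[simp] lemma discount_zero_right (s : ℂ) : discount s 0 = 1 := by simp [discount]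

lemma discount_ofReal_add (s : ℂ) {u : ℝ} (hu : 0 ≤ u) (τ : ENNReal) :
    discount s (ENNReal.ofReal u + τ) = Complex.exp (-s * u) * discount s τ := by
  unfold discount
  by_cases hτ : τ = ⊤
  · simp [hτ]
  · have h : ENNReal.ofReal u + τ ≠ ⊤ := ENNReal.add_ne_top.2 ⟨ENNReal.ofReal_ne_top, hτ⟩
    rw [if_neg h, if_neg hτ, ENNReal.toReal_add ENNReal.ofReal_ne_top hτ,
      ENNReal.toReal_ofReal hu, ← Complex.exp_add]
    push_cast
    ring_nf

lemma measurable_discount (s : ℂ) : Measurable (discount s) := by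
  unfold discount
  refine Measurable.ite (measurableSet_singleton ⊤) measurable_const ?_
  exact Complex.measurable_exp.comp
    ((Complex.measurable_ofReal.comp ENNReal.measurable_toReal).const_mul _)

lemma norm_exp_neg_mul_le {s : ℂ} (hs : 0 ≤ s.re) {t : ℝ} (ht : 0 ≤ t) :
    ‖Complex.exp (-s * t)‖ ≤ 1 := by
  rw [Complex.norm_exp, Real.exp_le_one_iff]
  simpa using mul_nonneg hs ht

lemma norm_discount_le {s : ℂ} (hs : 0 ≤ s.re) (τ : ENNReal) : ‖discount s τ‖ ≤ 1 := by
  unfold discount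
  split_ifs
  · simp
  · exact norm_exp_neg_mul_le hs ENNReal.toReal_nonneg

variable {G ν : Measure ℝ} [IsProbabilityMeasure G] [IsProbabilityMeasure ν]

lemma integral_pathLaw_eq_integral_fst {f : (ℕ → ℝ) × (ℕ → ℝ) → ℂ} (hf : Measurable f)
    {C : ℝ} (hC : ∀ z, ‖f z‖ ≤ C) :
    ∫ z, f z ∂pathLaw G ν = ∫ u, ∫ z, f (prepend u z.1, z.2) ∂pathLaw G ν ∂G := by
  have hmp := measurePreserving_prepend_fst G ν
  rw [← hmp.map_eq, integral_map hmp.aemeasurable hf.aestronglyMeasurable, hmp.map_eq,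
    integral_prod]
  exact Integrable.of_bound (hf.comp hmp.measurable).aestronglyMeasurable C
    (Eventually.of_forall fun _ => hC _)

lemma integral_pathLaw_eq_integral_snd {f : (ℕ → ℝ) × (ℕ → ℝ) → ℂ} (hf : Measurable f)
    {C : ℝ} (hC : ∀ z, ‖f z‖ ≤ C) :
    ∫ z, f z ∂pathLaw G ν = ∫ v, ∫ z, f (z.1, prepend v z.2) ∂pathLaw G ν ∂ν := by
  have hmp := measurePreserving_prepend_snd G ν
  rw [← hmp.map_eq, integral_map hmp.aemeasurable hf.aestronglyMeasurable, hmp.map_eq,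
    integral_prod]
  exact Integrable.of_bound (hf.comp hmp.measurable).aestronglyMeasurable C
    (Eventually.of_forall fun _ => hC _)

lemma integrable_integral_snd {f : (ℕ → ℝ) × (ℕ → ℝ) → ℂ} (hf : Measurable f)
    {C : ℝ} (hC : ∀ z, ‖f z‖ ≤ C) :
    Integrable (fun v => ∫ z, f (z.1, prepend v z.2) ∂pathLaw G ν) ν := by
  have hmp := measurePreserving_prepend_snd G ν
  refine Integrable.integral_prod_left (f := fun q : ℝ × ((ℕ → ℝ) × (ℕ → ℝ)) =>
    f (q.2.1, prepend q.1 q.2.2)) ?_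
  exact Integrable.of_bound (hf.comp hmp.measurable).aestronglyMeasurable C
    (Eventually.of_forall fun _ => hC _)

/-- `E exp (-s τ)` when the system starts with `j` broken elements; paths with `τ = ⊤` do not
contribute, so that the value at `s = 0` is the probability that `τ` is finite. -/
noncomputable def transform (n j : ℕ) (G ν : Measure ℝ) (s : ℂ) : ℂ :=
  ∫ z, discount s (lifetime n j z.1 z.2) ∂pathLaw G ν

/-- The transform `E exp (-s τ)` conditional on the first working time being `u`. -/
noncomputable def transformWork (n j : ℕ) (G ν : Measure ℝ) (s : ℂ) (u : ℝ) : ℂ :=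
  ∫ z, discount s (lifetime n j (prepend u z.1) z.2) ∂pathLaw G ν

/-- The transform `E exp (-s τ)` conditional on the first repair time being `v`. -/
noncomputable def transformRepair (n j : ℕ) (G ν : Measure ℝ) (s : ℂ) (v : ℝ) : ℂ :=
  ∫ z, discount s (lifetime n j z.1 (prepend v z.2)) ∂pathLaw G ν

lemma measurable_discount_lifetime (n j : ℕ) (s : ℂ) :
    Measurable fun z : (ℕ → ℝ) × (ℕ → ℝ) => discount s (lifetime n j z.1 z.2) :=
  (measurable_discount s).comp (measurable_lifetime n j)

lemma transform_eq_integral_work (n j : ℕ) {s : ℂ} (hs : 0 ≤ s.re) :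
    transform n j G ν s = ∫ u, transformWork n j G ν s u ∂G :=
  integral_pathLaw_eq_integral_fst (measurable_discount_lifetime n j s)
    fun _ => norm_discount_le hs _

lemma transform_eq_integral_repair (n j : ℕ) {s : ℂ} (hs : 0 ≤ s.re) :
    transform n j G ν s = ∫ v, transformRepair n j G ν s v ∂ν :=
  integral_pathLaw_eq_integral_snd (measurable_discount_lifetime n j s)
    fun _ => norm_discount_le hs _

lemma norm_transform_le (n j : ℕ) {s : ℂ} (hs : 0 ≤ s.re) : ‖transform n j G ν s‖ ≤ 1 := by
  unfold transform
  simpa using norm_integral_le_of_norm_le_const (μ := pathLaw G ν)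
    (Eventually.of_forall fun z => norm_discount_le hs (lifetime n j z.1 z.2))

lemma transformWork_zero {n : ℕ} (hn : 0 < n) (hG : ∀ᵐ t ∂G, 0 ≤ t) (s : ℂ) {u : ℝ}
    (hu : 0 ≤ u) :
    transformWork n 0 G ν s u = Complex.exp (-s * u) * transform n 1 G ν s := by
  rw [transformWork, transform, ← integral_const_mul]
  refine integral_congr_ae ?_
  filter_upwards [ae_pathLaw_of_ae (q := fun _ => True) hG
    (Eventually.of_forall fun _ => trivial)] with z hz
  rw [lifetime_zero_prepend hn _ hu hz.1, discount_ofReal_add s hu]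

/-- The boundary condition: a system started with all its elements broken has lifetime `0`. -/
lemma transform_self {n : ℕ} (hG : ∀ᵐ t ∂G, 0 ≤ t) (hν : ∀ᵐ t ∂ν, 0 < t) (s : ℂ) :
    transform n n G ν s = 1 := by
  have h : (fun z : (ℕ → ℝ) × (ℕ → ℝ) => discount s (lifetime n n z.1 z.2))
      =ᵐ[pathLaw G ν] fun _ => 1 := by
    filter_upwards [ae_pathLaw_of_ae hG hν] with z hz
    rw [lifetime_self hz.1 (fun i => (hz.2 i).le) (hz.2 0), discount_zero_right]
  rw [transform, integral_congr_ae h]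
  simp

/-! ### Exponential repair times -/

lemma expMeasure_eq_withDensity (μ : ℝ) :
    expMeasure μ = volume.withDensity (exponentialPDF μ) := rfl

lemma measurable_exponentialPDF (μ : ℝ) : Measurable (exponentialPDF μ) :=
  (measurable_exponentialPDFReal μ).ennreal_ofReal

lemma setIntegral_expMeasure (μ : ℝ) (f : ℝ → ℂ) {S : Set ℝ} (hS : MeasurableSet S) :
    ∫ v in S, f v ∂expMeasure μ = ∫ v in S, (exponentialPDF μ v).toReal • f v := by
  rw [expMeasure_eq_withDensity]
  exact setIntegral_withDensity_eq_setIntegral_toReal_smul₀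
    (measurable_exponentialPDF μ).aemeasurable
    (Eventually.of_forall fun _ => ENNReal.ofReal_lt_top) f hS

lemma exponentialPDF_toReal {μ v : ℝ} (hμ : 0 < μ) (hv : 0 ≤ v) :
    (exponentialPDF μ v).toReal = μ * Real.exp (-(μ * v)) := by
  rw [exponentialPDF_of_nonneg hv, ENNReal.toReal_ofReal (by positivity)]

lemma expMeasure_Iic_zero (μ : ℝ) : expMeasure μ (Set.Iic 0) = 0 := by
  rw [expMeasure_eq_withDensity, withDensity_apply _ measurableSet_Iic,
    setLIntegral_congr Iio_ae_eq_Iic.symm]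
  exact lintegral_exponentialPDF_of_nonpos le_rfl

lemma ae_expMeasure_pos (μ : ℝ) : ∀ᵐ v ∂expMeasure μ, 0 < v := by
  rw [ae_iff]
  simp only [not_lt]
  exact expMeasure_Iic_zero μ

lemma setIntegral_expMeasure_Iic {μ u : ℝ} (hμ : 0 < μ) (hu : 0 ≤ u) (f : ℝ → ℂ) :
    ∫ v in Set.Iic u, f v ∂expMeasure μ =
      ∫ v in (0 : ℝ)..u, ((μ * Real.exp (-(μ * v)) : ℝ) : ℂ) * f v := by
  have hr : (expMeasure μ).restrict (Set.Iic u) = (expMeasure μ).restrict (Set.Ioc 0 u) := by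
    refine Measure.restrict_congr_set ?_
    filter_upwards [ae_expMeasure_pos μ] with v hv
    exact propext ⟨fun h => ⟨hv, h⟩, fun h => h.2⟩
  rw [hr, setIntegral_expMeasure μ f measurableSet_Ioc, intervalIntegral.integral_of_le hu]
  refine setIntegral_congr_fun measurableSet_Ioc fun v hv => ?_
  simp only [exponentialPDF_toReal hμ hv.1.le, Complex.real_smul]

/-- The memoryless property of the exponential distribution. -/
lemma setIntegral_expMeasure_Ioi_comp_sub {μ u : ℝ} (hμ : 0 < μ) (hu : 0 ≤ u) (f : ℝ → ℂ) :
    ∫ v in Set.Ioi u, f (v - u) ∂expMeasure μ =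
      Real.exp (-(μ * u)) * ∫ v, f v ∂expMeasure μ := by
  have hr : (expMeasure μ) = (expMeasure μ).restrict (Set.Ioi 0) :=
    (Measure.restrict_eq_self_of_ae_mem (ae_expMeasure_pos μ)).symm
  rw [setIntegral_expMeasure μ _ measurableSet_Ioi]
  conv_rhs => rw [hr, setIntegral_expMeasure μ _ measurableSet_Ioi]
  rw [← integral_const_mul, ← integral_indicator measurableSet_Ioi,
    ← integral_indicator measurableSet_Ioi]
  conv_rhs => rw [← integral_sub_right_eq_self _ u]
  refine integral_congr_ae (Eventually.of_forall fun v => ?_)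
  by_cases hv : u < v
  · have h1 : v ∈ Set.Ioi u := hv
    have h2 : v - u ∈ Set.Ioi (0 : ℝ) := sub_pos.2 hv
    simp only [Set.indicator_of_mem h1, Set.indicator_of_mem h2,
      exponentialPDF_toReal hμ (hu.trans hv.le), exponentialPDF_toReal hμ (sub_pos.2 hv).le,
      Complex.real_smul]
    rw [← mul_assoc, ← Complex.ofReal_mul]
    congr 2
    rw [mul_left_comm, ← Real.exp_add]
    ring_nf
  · have h1 : v ∉ Set.Ioi u := hv
    have h2 : v - u ∉ Set.Ioi (0 : ℝ) := by simpa using hv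
    simp only [Set.indicator_of_notMem h1, Set.indicator_of_notMem h2]

lemma measurable_discount_lifetime_prepend (n j : ℕ) (s : ℂ) (u : ℝ) :
    Measurable fun z : (ℕ → ℝ) × (ℕ → ℝ) => discount s (lifetime n j (prepend u z.1) z.2) := by
  have hq : Measurable fun x : ℕ → ℝ => ((u, x) : ℝ × (ℕ → ℝ)) := measurable_prodMk_left
  have hp : Measurable fun x : ℕ → ℝ => prepend u x := measurable_prepend.comp hq
  have hp' : Measurable fun z : (ℕ → ℝ) × (ℕ → ℝ) => (prepend u z.1, z.2) :=
    (hp.comp measurable_fst).prodMk measurable_snd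
  simpa only [Function.comp_def] using (measurable_discount_lifetime n j s).comp hp'

lemma integral_prepend_of_le {n j : ℕ} (hj : j + 1 < n) (hG : ∀ᵐ t ∂G, 0 ≤ t)
    (hν : ∀ᵐ t ∂ν, 0 < t) (s : ℂ) {u v : ℝ} (hv : 0 ≤ v) (hvu : v ≤ u) :
    ∫ z, discount s (lifetime n (j + 1) (prepend u z.1) (prepend v z.2)) ∂pathLaw G ν =
      Complex.exp (-s * v) * transformWork n j G ν s (u - v) := by
  rw [transformWork, ← integral_const_mul]
  refine integral_congr_ae ?_
  filter_upwards [ae_pathLaw_of_ae hG hν] with z hz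
  rw [lifetime_prepend_of_le hj hv hvu hz.1 fun i => (hz.2 i).le, discount_ofReal_add s hv]

lemma integral_prepend_of_lt {n j : ℕ} (hj : j + 1 < n) (hG : ∀ᵐ t ∂G, 0 ≤ t)
    (hν : ∀ᵐ t ∂ν, 0 < t) (s : ℂ) {u v : ℝ} (hu : 0 ≤ u) (huv : u < v) :
    ∫ z, discount s (lifetime n (j + 1) (prepend u z.1) (prepend v z.2)) ∂pathLaw G ν =
      Complex.exp (-s * u) * transformRepair n (j + 2) G ν s (v - u) := by
  rw [transformRepair, ← integral_const_mul]
  refine integral_congr_ae ?_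
  filter_upwards [ae_pathLaw_of_ae hG hν] with z hz
  rw [lifetime_prepend_of_lt hj hu huv hz.1 fun i => (hz.2 i).le, discount_ofReal_add s hu]

/-- The renewal equation: either the first repair outlasts the first working time `u`, or it ends
at an instant `v ≤ u`. -/
lemma transformWork_succ {n j : ℕ} (hj : j + 1 < n) (hG : ∀ᵐ t ∂G, 0 ≤ t) {μ : ℝ} (hμ : 0 < μ)
    {s : ℂ} (hs : 0 ≤ s.re) {u : ℝ} (hu : 0 ≤ u) :
    transformWork n (j + 1) G (expMeasure μ) s u =
      (∫ v in (0 : ℝ)..u, ((μ * Real.exp (-(μ * v)) : ℝ) : ℂ) *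
        (Complex.exp (-s * v) * transformWork n j G (expMeasure μ) s (u - v))) +
      Complex.exp (-s * u) * (Real.exp (-(μ * u)) * transform n (j + 2) G (expMeasure μ) s) := by
  have := isProbabilityMeasure_expMeasure hμ
  have hpos := ae_expMeasure_pos μ
  have hf := measurable_discount_lifetime_prepend n (j + 1) s u
  have hC : ∀ z : (ℕ → ℝ) × (ℕ → ℝ),
      ‖discount s (lifetime n (j + 1) (prepend u z.1) z.2)‖ ≤ 1 := fun _ => norm_discount_le hs _
  have hI := integrable_integral_snd (G := G) (ν := expMeasure μ) hf hC
  have hF := integral_pathLaw_eq_integral_snd (G := G) (ν := expMeasure μ) hf hC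
  rw [transformWork, hF, ← integral_add_compl measurableSet_Iic hI, Set.compl_Iic]
  congr 1
  · rw [← setIntegral_expMeasure_Iic hμ hu]
    refine setIntegral_congr_ae measurableSet_Iic ?_
    filter_upwards [hpos] with v hv hvu
    exact integral_prepend_of_le hj hG hpos s hv.le hvu
  · rw [transform_eq_integral_repair n (j + 2) hs, ← setIntegral_expMeasure_Ioi_comp_sub hμ hu,
      ← integral_const_mul]
    refine setIntegral_congr_fun measurableSet_Ioi fun v huv => ?_
    exact integral_prepend_of_lt hj hG hpos s hu huv

/-- The probability `exp (-r) r ^ k / k!` that a Poisson variable of mean `r` takes the value `k`: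
with `r = μ u`, the probability that exactly `k` repairs of a busy device end during a time `u`. -/
noncomputable def poissonWeight (k : ℕ) (r : ℝ) : ℝ :=
  Real.exp (-r) * (r ^ k / k.factorial)

/-- The `k + 1` repairs ending during `u` are a first one, ending at `v`, and `k` during `u - v`. -/
lemma integral_mul_poissonWeight (k : ℕ) (μ u : ℝ) :
    ∫ v in (0 : ℝ)..u, μ * Real.exp (-(μ * v)) * poissonWeight k (μ * (u - v)) =
      poissonWeight (k + 1) (μ * u) := by
  have hd : ∀ v ∈ Set.uIcc (0 : ℝ) u, HasDerivAt
      (fun v => -(Real.exp (-(μ * u)) * ((μ * (u - v)) ^ (k + 1) / (k + 1).factorial)))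
      (μ * Real.exp (-(μ * v)) * poissonWeight k (μ * (u - v))) v := by
    intro v _
    have h1 : HasDerivAt (fun v => μ * (u - v)) (-μ) v := by
      simpa using ((hasDerivAt_id v).const_sub u).const_mul μ
    refine (((h1.pow (k + 1)).div_const ((k + 1).factorial : ℝ)).const_mul
      (Real.exp (-(μ * u)))).neg.congr_deriv ?_
    have he : Real.exp (-(μ * u)) = Real.exp (-(μ * v)) * Real.exp (-(μ * (u - v))) := by
      rw [← Real.exp_add]; ring_nf
    have hk : (k.factorial : ℝ) ≠ 0 := by positivity
    rw [he, poissonWeight, Nat.factorial_succ]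
    push_cast
    field_simp
  rw [intervalIntegral.integral_eq_sub_of_hasDerivAt hd
    (Continuous.intervalIntegrable (by unfold poissonWeight; fun_prop) _ _)]
  simp [poissonWeight]

lemma integral_exp_neg_mul (μ u : ℝ) :
    ∫ v in (0 : ℝ)..u, μ * Real.exp (-(μ * v)) = 1 - Real.exp (-(μ * u)) := by
  rw [intervalIntegral.integral_eq_sub_of_hasDerivAt
    (f := fun v => -Real.exp (-(μ * v))) (fun v _ => hasDerivAt_neg_exp_mul_exp)
    (Continuous.intervalIntegrable (by fun_prop) _ _)]
  simp
  ring

/-- Conditionally on the first working time `u`, `k` repairs end before the first breakdown with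
the Poisson probability if `k < j`, and otherwise the queue empties: the system is then renewed
with `j + 1 - k` broken elements, or with a single one. -/
lemma transformWork_eq {n j : ℕ} (hj : j < n) (hG : ∀ᵐ t ∂G, 0 ≤ t) {μ : ℝ} (hμ : 0 < μ)
    {s : ℂ} (hs : 0 ≤ s.re) {u : ℝ} (hu : 0 ≤ u) :
    transformWork n j G (expMeasure μ) s u = Complex.exp (-s * u) *
      (transform n 1 G (expMeasure μ) s + ∑ k ∈ Finset.range j, (poissonWeight k (μ * u) : ℂ) *
        (transform n (j + 1 - k) G (expMeasure μ) s - transform n 1 G (expMeasure μ) s)) := by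
  have := isProbabilityMeasure_expMeasure hμ
  induction j generalizing u with
  | zero => simp [transformWork_zero hj hG s hu]
  | succ j ih =>
    set φ := fun i => transform n i G (expMeasure μ) s with hφ
    have hcongr : ∫ v in (0 : ℝ)..u, ((μ * Real.exp (-(μ * v)) : ℝ) : ℂ) *
        (Complex.exp (-s * v) * transformWork n j G (expMeasure μ) s (u - v)) =
        ∫ v in (0 : ℝ)..u, (Complex.exp (-s * u) * φ 1 * ((μ * Real.exp (-(μ * v)) : ℝ) : ℂ) +
          ∑ k ∈ Finset.range j, Complex.exp (-s * u) * (φ (j + 1 - k) - φ 1) *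
            ((μ * Real.exp (-(μ * v)) * poissonWeight k (μ * (u - v)) : ℝ) : ℂ)) := by
      refine intervalIntegral.integral_congr fun v hv => ?_
      rw [Set.uIcc_of_le hu] at hv
      have he : Complex.exp (-s * u) = Complex.exp (-s * v) * Complex.exp (-s * (u - v : ℝ)) := by
        rw [← Complex.exp_add]; push_cast; ring_nf
      simp only [ih (by omega) (sub_nonneg.2 hv.2), he, mul_add, Finset.mul_sum]
      congr 1
      · simp only [hφ]; ring
      · refine Finset.sum_congr rfl fun k _ => ?_
        simp only [hφ]; push_cast; ring
    have hint : ∀ c : ℂ, ∀ g : ℝ → ℝ, Continuous g →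
        IntervalIntegrable (fun v => c * (g v : ℂ)) volume 0 u := fun c g hg =>
      Continuous.intervalIntegrable (by fun_prop) _ _
    have hcont : ∀ k, Continuous fun v =>
        μ * Real.exp (-(μ * v)) * poissonWeight k (μ * (u - v)) := fun k => by
      unfold poissonWeight; fun_prop
    have hsum : IntervalIntegrable (fun v => ∑ k ∈ Finset.range j,
        Complex.exp (-s * u) * (φ (j + 1 - k) - φ 1) *
          ((μ * Real.exp (-(μ * v)) * poissonWeight k (μ * (u - v)) : ℝ) : ℂ)) volume 0 u :=
      Continuous.intervalIntegrable (continuous_finsetSum _ fun k _ =>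
        continuous_const.mul (Complex.continuous_ofReal.comp (hcont k))) _ _
    rw [transformWork_succ hj hG hμ hs hu, hcongr, intervalIntegral.integral_add
      (hint (Complex.exp (-s * u) * φ 1) (fun v => μ * Real.exp (-(μ * v))) (by fun_prop)) hsum,
      intervalIntegral.integral_finsetSum fun k _ => hint _ _ (hcont k)]
    simp only [intervalIntegral.integral_const_mul]
    simp only [intervalIntegral.integral_ofReal,
      integral_mul_poissonWeight, integral_exp_neg_mul]
    rw [Finset.sum_range_succ']
    simp only [Nat.add_sub_add_right]
    have h0 : poissonWeight 0 (μ * u) = Real.exp (-(μ * u)) := by simp [poissonWeight]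
    rw [h0, mul_add, mul_add, Finset.mul_sum]
    have hs : ∀ k, Complex.exp (-s * u) * (φ (j + 1 - k) - φ 1) *
        (poissonWeight (k + 1) (μ * u) : ℂ) = Complex.exp (-s * u) *
        ((poissonWeight (k + 1) (μ * u) : ℂ) * (φ (j + 1 - k) - φ 1)) := fun k => by ring
    simp only [hs]
    simp only [hφ]
    push_cast
    ring

end Transform

/-! ### The linear system satisfied by the transforms -/

section Asymptotics

/-- `∫ exp (-s u) exp (-μ u) (μ u) ^ k / k! dG(u)`: the weight, discounted by the working time, of
exactly `k` repairs during that time. -/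
noncomputable def repairWeight (G : Measure ℝ) (μ : ℝ) (k : ℕ) (s : ℂ) : ℂ :=
  ∫ u, Complex.exp (-s * u) * (poissonWeight k (μ * u) : ℂ) ∂G

/-- `∫ exp (-s u) dG(u)`. -/
noncomputable def workTransform (G : Measure ℝ) (s : ℂ) : ℂ := ∫ u, Complex.exp (-s * (u : ℂ)) ∂G

lemma poissonWeight_nonneg (k : ℕ) {r : ℝ} (hr : 0 ≤ r) : 0 ≤ poissonWeight k r := by
  unfold poissonWeight; positivity

lemma poissonWeight_le_one (k : ℕ) {r : ℝ} (hr : 0 ≤ r) : poissonWeight k r ≤ 1 := by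
  have h := mul_le_mul_of_nonneg_left (Real.pow_div_factorial_le_exp r hr k) (Real.exp_nonneg (-r))
  rwa [← Real.exp_add, neg_add_cancel, Real.exp_zero] at h

lemma continuous_poissonWeight (k : ℕ) : Continuous (poissonWeight k) := by
  unfold poissonWeight; fun_prop

lemma norm_exp_mul_poissonWeight_le (k : ℕ) {μ u : ℝ} (hμ : 0 ≤ μ) {s : ℂ} (hs : 0 ≤ s.re)
    (hu : 0 ≤ u) : ‖Complex.exp (-s * u) * (poissonWeight k (μ * u) : ℂ)‖ ≤
      poissonWeight k (μ * u) := by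
  have h0 := poissonWeight_nonneg k (mul_nonneg hμ hu)
  rw [norm_mul, Complex.norm_real, Real.norm_of_nonneg h0]
  exact mul_le_of_le_one_left h0 (norm_exp_neg_mul_le hs hu)

lemma aestronglyMeasurable_exp_mul_poissonWeight (G : Measure ℝ) (k : ℕ) (μ : ℝ) (s : ℂ) :
    AEStronglyMeasurable
      (fun u : ℝ => Complex.exp (-s * u) * (poissonWeight k (μ * u) : ℂ)) G := by
  have := continuous_poissonWeight k
  exact Continuous.aestronglyMeasurable (by fun_prop)

lemma repairWeight_zero (G : Measure ℝ) (μ : ℝ) (s : ℂ) :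
    repairWeight G μ 0 s = ∫ u, Complex.exp (-s * u) * (Real.exp (-μ * u) : ℂ) ∂G := by
  simp [repairWeight, poissonWeight]

lemma repairWeight_zero_zero (G : Measure ℝ) (μ : ℝ) : repairWeight G μ 0 0 = (eps G μ : ℂ) := by
  rw [repairWeight_zero, eps, ← integral_complex_ofReal]
  simp

variable {G : Measure ℝ} [IsProbabilityMeasure G]

lemma integrable_exp_neg_mul (hG : ∀ᵐ t ∂G, 0 ≤ t) {s : ℂ} (hs : 0 ≤ s.re) :
    Integrable (fun u : ℝ => Complex.exp (-s * u)) G :=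
  Integrable.of_bound (Continuous.aestronglyMeasurable (by fun_prop)) 1 <| by
    filter_upwards [hG] with u hu using norm_exp_neg_mul_le hs hu

lemma integrable_exp_mul_poissonWeight (hG : ∀ᵐ t ∂G, 0 ≤ t) (k : ℕ) {μ : ℝ} (hμ : 0 ≤ μ) {s : ℂ}
    (hs : 0 ≤ s.re) :
    Integrable (fun u : ℝ => Complex.exp (-s * u) * (poissonWeight k (μ * u) : ℂ)) G :=
  Integrable.of_bound (aestronglyMeasurable_exp_mul_poissonWeight G k μ s) 1 <| by
    filter_upwards [hG] with u hu
    exact (norm_exp_mul_poissonWeight_le k hμ hs hu).trans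
      (poissonWeight_le_one k (mul_nonneg hμ hu))

/-- The linear system: integrate `transformWork_eq` over the law of the first working time. -/
lemma transform_eq {n j : ℕ} (hj : j < n) (hG : ∀ᵐ t ∂G, 0 ≤ t) {μ : ℝ} (hμ : 0 < μ) {s : ℂ}
    (hs : 0 ≤ s.re) :
    transform n j G (expMeasure μ) s = workTransform G s * transform n 1 G (expMeasure μ) s +
      ∑ k ∈ Finset.range j, repairWeight G μ k s *
        (transform n (j + 1 - k) G (expMeasure μ) s - transform n 1 G (expMeasure μ) s) := by
  have := isProbabilityMeasure_expMeasure hμ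
  rw [transform_eq_integral_work n j hs]
  have hcongr : ∀ᵐ u ∂G, transformWork n j G (expMeasure μ) s u =
      Complex.exp (-s * u) * transform n 1 G (expMeasure μ) s +
        ∑ k ∈ Finset.range j, Complex.exp (-s * u) * (poissonWeight k (μ * u) : ℂ) *
        (transform n (j + 1 - k) G (expMeasure μ) s - transform n 1 G (expMeasure μ) s) := by
    filter_upwards [hG] with u hu
    rw [transformWork_eq hj hG hμ hs hu, mul_add, Finset.mul_sum]
    simp only [mul_assoc]
  have hint : ∀ k, Integrable (fun u : ℝ => Complex.exp (-s * u) * (poissonWeight k (μ * u) : ℂ) *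
      (transform n (j + 1 - k) G (expMeasure μ) s - transform n 1 G (expMeasure μ) s)) G :=
    fun k => (integrable_exp_mul_poissonWeight hG k hμ.le hs).mul_const _
  rw [integral_congr_ae hcongr, integral_add ((integrable_exp_neg_mul hG hs).mul_const _)
    (integrable_finsetSum _ fun k _ => hint k), integral_finsetSum _ fun k _ => hint k]
  simp only [integral_mul_const, workTransform, repairWeight]

lemma integrable_exp_neg_mul_real (hG : ∀ᵐ t ∂G, 0 ≤ t) {μ : ℝ} (hμ : 0 ≤ μ) :
    Integrable (fun u : ℝ => Real.exp (-μ * u)) G :=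
  Integrable.of_bound (Continuous.aestronglyMeasurable (by fun_prop)) 1 <| by
    filter_upwards [hG] with u hu
    rw [Real.norm_of_nonneg (Real.exp_nonneg _), Real.exp_le_one_iff]
    nlinarith

lemma eps_pos (hG : ∀ᵐ t ∂G, 0 ≤ t) {μ : ℝ} (hμ : 0 ≤ μ) : 0 < eps G μ :=
  integral_exp_pos (integrable_exp_neg_mul_real hG hμ)

/-- At `s = 0` the linear system forces all the transforms to be equal to `1`. -/
lemma transform_zero {n j : ℕ} (hn : 2 ≤ n) (hj : j < n) (hG : ∀ᵐ t ∂G, 0 ≤ t) {μ : ℝ}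
    (hμ : 0 < μ) : transform n j G (expMeasure μ) 0 = 1 := by
  have := isProbabilityMeasure_expMeasure hμ
  have hw : workTransform G 0 = 1 := by simp [workTransform]
  have hε : repairWeight G μ 0 0 ≠ 0 := by
    rw [repairWeight_zero_zero]
    exact_mod_cast (eps_pos hG hμ.le).ne'
  have hrec := fun (i : ℕ) (hi : i < n) => transform_eq hi hG hμ (s := 0) le_rfl
  simp only [hw, one_mul] at hrec
  have hall : ∀ m, m < n →
      transform n (m + 1) G (expMeasure μ) 0 = transform n 1 G (expMeasure μ) 0 := by
    intro m
    induction m using Nat.strong_induction_on with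
    | _ m ih =>
      intro hm
      rcases m with _ | m
      · rfl
      have h := hrec (m + 1) hm
      rw [ih m (by omega) (by omega), Finset.sum_range_succ', Finset.sum_eq_zero] at h
      · simpa [hε, sub_eq_zero] using h
      · intro k hk
        have hk' := Finset.mem_range.1 hk
        rw [show m + 1 + 1 - (k + 1) = (m - k) + 1 by omega, ih (m - k) (by omega) (by omega),
          sub_self, mul_zero]
  have h1 : transform n 1 G (expMeasure μ) 0 = 1 := by
    have h := hall (n - 1) (by omega)
    rwa [Nat.sub_add_cancel (by omega), transform_self hG (ae_expMeasure_pos μ), eq_comm] at h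
  rcases j with _ | j
  · simpa [h1] using hrec 0 hj
  · rw [hall j (by omega), h1]

/-! ### Asymptotics as the repair rate tends to infinity -/

/-- The limit of the solution of the linear system: with
`E m = (φ (m + 1) - φ 1) e ^ m / e ^ (n - 1)`, the differences `E m - c φ 1`, `1 ≤ m`, tend to zero,
whereas `E (n - 1) = 1 - φ 1`. -/
lemma tendsto_of_linear_system {α : Type*} {l : Filter α} {n : ℕ} (hn : 2 ≤ n) {e g : α → ℂ}
    {a φ : ℕ → α → ℂ} {c : ℂ} (hc : 1 + c ≠ 0) (he : Tendsto e l (𝓝 0)) (he0 : ∀ᶠ x in l, e x ≠ 0)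
    (ha0 : Tendsto (fun x => a 0 x / e x) l (𝓝 1)) (ha : ∀ k, Tendsto (a (k + 1)) l (𝓝 0))
    (hg : Tendsto (fun x => (1 - g x) / e x ^ (n - 1)) l (𝓝 c))
    (hφ1 : ∀ᶠ x in l, ‖φ 1 x‖ ≤ 1) (hφn : ∀ᶠ x in l, φ n x = 1)
    (hrec : ∀ i < n, ∀ᶠ x in l, φ i x = g x * φ 1 x +
      ∑ k ∈ Finset.range i, a k x * (φ (i + 1 - k) x - φ 1 x))
    {j : ℕ} (hj : j < n) : Tendsto (φ j) l (𝓝 (1 / (1 + c))) := by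
  obtain ⟨N, rfl⟩ : ∃ N, n = N + 2 := ⟨n - 2, by omega⟩
  simp only [show N + 2 - 1 = N + 1 by omega] at hg
  have hbdd : ∀ {f : α → ℂ}, Tendsto f l (𝓝 0) → Tendsto (fun x => f x * φ 1 x) l (𝓝 0) :=
    fun hf => hf.zero_mul_isBoundedUnder_le ⟨1, by simpa using hφ1⟩
  set E : ℕ → α → ℂ := fun m x => (φ (m + 1) x - φ 1 x) * e x ^ m / e x ^ (N + 1) with hE
  set B : α → ℂ := fun x => (1 - g x) / e x ^ (N + 1) with hB
  set r : α → ℂ := fun x => (a 0 x / e x)⁻¹ with hr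
  have hr1 : Tendsto r l (𝓝 1) := by
    have h := ha0.inv₀ one_ne_zero
    rwa [inv_one] at h
  have hane : ∀ᶠ x in l, a 0 x / e x ≠ 0 := ha0.eventually_ne one_ne_zero
  -- The equation for `φ (m + 1)`, multiplied by `e ^ m / e ^ (N + 1)` and solved for `E (m + 1)`.
  have hErec : ∀ m < N + 1, ∀ᶠ x in l, E (m + 1) x = r x * (E m x + B x * e x ^ m * φ 1 x -
      ∑ k ∈ Finset.range m, a (k + 1) x * e x ^ k * E (m - k) x) := by
    intro m hm
    filter_upwards [he0, hane, hrec (m + 1) (by omega)] with x hx hax h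
    rw [Finset.sum_range_succ'] at h
    have hsum : ∑ k ∈ Finset.range m, a (k + 1) x * e x ^ k * E (m - k) x =
        (∑ k ∈ Finset.range m, a (k + 1) x * (φ (m + 1 + 1 - (k + 1)) x - φ 1 x)) *
          (e x ^ m / e x ^ (N + 1)) := by
      rw [Finset.sum_mul]
      refine Finset.sum_congr rfl fun k hk => ?_
      have hk' := Finset.mem_range.1 hk
      have hpow : e x ^ m = e x ^ k * e x ^ (m - k) := by
        rw [← pow_add, Nat.add_sub_cancel' hk'.le]
      simp only [hE]
      rw [hpow, show m + 1 + 1 - (k + 1) = m - k + 1 by omega]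
      ring
    have ha0' : a 0 x ≠ 0 := fun h0 => hax (by simp [h0])
    rw [hsum, hr, eq_comm, inv_mul_eq_iff_eq_mul₀ hax]
    simp only [hE, hB]
    simp only [Nat.sub_zero] at h
    generalize (∑ k ∈ Finset.range m,
      a (k + 1) x * (φ (m + 1 + 1 - (k + 1)) x - φ 1 x)) = S at h ⊢
    rw [pow_succ (e x) m]
    field_simp
    linear_combination h
  -- For `m = 0` the main term `c φ 1` comes from `B φ 1`; for `m ≥ 1` it is inherited from `E m`.
  have hlim : ∀ m, m < N + 1 → Tendsto (fun x => E (m + 1) x - c * φ 1 x) l (𝓝 0) := by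
    intro m
    induction m using Nat.strong_induction_on with
    | _ m ih =>
      intro hm
      rcases m with _ | m
      · have h : Tendsto (fun x => (r x * B x - c) * φ 1 x) l (𝓝 0) :=
          hbdd (by simpa using (hr1.mul hg).sub_const c)
        refine h.congr' ?_
        filter_upwards [hErec 0 hm] with x hx
        rw [hx]
        simp [hE]
        ring
      · have h1 : Tendsto (fun x => r x * (E (m + 1) x - c * φ 1 x)) l (𝓝 0) := by
          simpa using hr1.mul (ih m (by omega) (by omega))
        have h2 : Tendsto (fun x => ((r x - 1) * c + r x * (B x * e x ^ (m + 1))) * φ 1 x) l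
            (𝓝 0) := by
          refine hbdd ?_
          simpa using ((hr1.sub_const 1).mul_const c).add (hr1.mul (hg.mul (he.pow (m + 1))))
        have h3 : ∀ k ∈ Finset.range (m + 1), Tendsto
            (fun x => a (k + 1) x * e x ^ k * E (m + 1 - k) x) l (𝓝 0) := by
          intro k hk
          have hk' := Finset.mem_range.1 hk
          have hae : Tendsto (fun x => a (k + 1) x * e x ^ k) l (𝓝 0) := by
            simpa using (ha k).mul (he.pow k)
          have h4 := (hae.mul (ih (m - k) (by omega) (by omega))).add
            ((hbdd hae).mul_const c)
          simp only [zero_mul, mul_zero, add_zero] at h4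
          refine h4.congr fun x => ?_
          rw [show m + 1 - k = m - k + 1 by omega]
          ring
        have h5 := (h1.add h2).sub (hr1.mul (tendsto_finsetSum _ h3))
        simp only [Finset.sum_const_zero, mul_zero, add_zero, sub_zero] at h5
        refine h5.congr' ?_
        filter_upwards [hErec (m + 1) hm] with x hx
        rw [hx]
        ring
  -- The boundary condition reads `E (N + 1) = 1 - φ 1`, so that `1 - (1 + c) φ 1` tends to zero.
  have h1 : Tendsto (φ 1) l (𝓝 (1 / (1 + c))) := by
    have h : Tendsto (fun x => (1 - (E (N + 1) x - c * φ 1 x)) / (1 + c)) l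
        (𝓝 ((1 - 0) / (1 + c))) := ((hlim N (by omega)).const_sub 1).div_const _
    rw [sub_zero] at h
    refine h.congr' ?_
    filter_upwards [he0, hφn] with x hx hxn
    have hEN : E (N + 1) x = 1 - φ 1 x := by
      simp only [hE]
      rw [show N + 1 + 1 = N + 2 by omega, hxn, mul_div_assoc, div_self (pow_ne_zero _ hx), mul_one]
    rw [hEN]
    field_simp
    ring
  rcases j with _ | j
  · have hg1 : Tendsto g l (𝓝 1) := by
      have h := (hg.mul (he.pow (N + 1))).const_sub 1
      simp only [zero_pow (Nat.succ_ne_zero N), mul_zero, sub_zero] at h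
      refine h.congr' ?_
      filter_upwards [he0] with x hx
      rw [div_mul_cancel₀ _ (pow_ne_zero _ hx)]
      ring
    have h := hg1.mul h1
    rw [one_mul] at h
    refine h.congr' ?_
    filter_upwards [hrec 0 hj] with x hx
    simp [hx]
  · rcases j with _ | j
    · exact h1
    have hEj : Tendsto (fun x => φ 1 x + (E (j + 1) x - c * φ 1 x + c * φ 1 x) * e x ^ (N - j)) l
        (𝓝 (1 / (1 + c) + (0 + c * (1 / (1 + c))) * 0 ^ (N - j))) :=
      h1.add (((hlim j (by omega)).add (h1.const_mul c)).mul (he.pow _))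
    rw [zero_pow (by omega), mul_zero, add_zero] at hEj
    refine hEj.congr' ?_
    filter_upwards [he0] with x hx
    have hpow : e x ^ (N + 1) = e x ^ (j + 1) * e x ^ (N - j) := by
      rw [← pow_add]; congr 1; omega
    simp only [hE, sub_add_cancel]
    rw [hpow]
    field_simp
    ring

lemma tendsto_poissonWeight (k : ℕ) : Tendsto (poissonWeight k) atTop (𝓝 0) := by
  have h := (Real.tendsto_pow_mul_exp_neg_atTop_nhds_zero k).div_const (k.factorial : ℝ)
  rw [zero_div] at h
  refine h.congr fun r => ?_
  rw [poissonWeight]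
  ring

lemma tendsto_integral_poissonWeight (hG : ∀ᵐ t ∂G, 0 < t) (k : ℕ) :
    Tendsto (fun μ => ∫ u, poissonWeight k (μ * u) ∂G) atTop (𝓝 0) := by
  have h := tendsto_integral_filter_of_dominated_convergence (μ := G) (l := atTop)
    (F := fun μ u => poissonWeight k (μ * u)) (f := fun _ => 0) (fun _ => (1 : ℝ))
    (Eventually.of_forall fun μ =>
      ((continuous_poissonWeight k).comp (continuous_const_mul μ)).aestronglyMeasurable)
    ?_ (integrable_const _) ?_
  · simpa using h
  · filter_upwards [eventually_ge_atTop 0] with μ hμ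
    filter_upwards [hG] with u hu
    rw [Real.norm_of_nonneg (poissonWeight_nonneg k (mul_nonneg hμ hu.le))]
    exact poissonWeight_le_one k (mul_nonneg hμ hu.le)
  · filter_upwards [hG] with u hu
    exact (tendsto_poissonWeight k).comp (tendsto_id.atTop_mul_const hu)

lemma tendsto_eps (hG : ∀ᵐ t ∂G, 0 < t) : Tendsto (eps G) atTop (𝓝 0) := by
  refine (tendsto_integral_poissonWeight hG 0).congr fun μ => ?_
  simp [eps, poissonWeight]

lemma tendsto_repairWeight (hG : ∀ᵐ t ∂G, 0 < t) (k : ℕ) {σ : ℝ → ℂ}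
    (hσ : ∀ᶠ μ in atTop, 0 ≤ (σ μ).re) :
    Tendsto (fun μ => repairWeight G μ k (σ μ)) atTop (𝓝 0) := by
  refine squeeze_zero_norm' ?_ (tendsto_integral_poissonWeight hG k)
  filter_upwards [eventually_ge_atTop 0, hσ] with μ hμ hs
  refine norm_integral_le_of_norm_le ?_ ?_
  · refine Integrable.of_bound ((continuous_poissonWeight k).comp
      (continuous_const_mul μ)).aestronglyMeasurable 1 ?_
    filter_upwards [hG] with u hu
    rw [Real.norm_of_nonneg (poissonWeight_nonneg k (mul_nonneg hμ hu.le))]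
    exact poissonWeight_le_one k (mul_nonneg hμ hu.le)
  · filter_upwards [hG] with u hu using norm_exp_mul_poissonWeight_le k hμ hs hu.le

lemma norm_exp_neg_sub_one_le {z : ℂ} (hz : 0 ≤ z.re) : ‖Complex.exp (-z) - 1‖ ≤ 2 * ‖z‖ := by
  by_cases h : ‖z‖ ≤ 1
  · simpa using Complex.norm_exp_sub_one_le (x := -z) (by simpa using h)
  · have h1 : ‖Complex.exp (-z)‖ ≤ 1 := by
      rw [Complex.norm_exp, Real.exp_le_one_iff]
      simpa using hz
    have h2 := norm_sub_le (Complex.exp (-z)) 1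
    rw [norm_one] at h2
    linarith

lemma tendsto_one_sub_workTransform_div (hG : ∀ᵐ t ∂G, 0 ≤ t)
    (hint : Integrable (fun t : ℝ => t) G) {s : ℂ} (hs : 0 ≤ s.re) :
    Tendsto (fun δ : ℝ => (1 - workTransform G (δ * s)) / δ) (𝓝[>] 0)
      (𝓝 ((∫ t, t ∂G : ℝ) * s)) := by
  have hre : ∀ {δ : ℝ}, 0 < δ → 0 ≤ ((δ : ℂ) * s).re := fun hδ => by
    simpa using mul_nonneg hδ.le hs
  have h := tendsto_integral_filter_of_dominated_convergence (μ := G) (l := 𝓝[>] (0 : ℝ))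
    (F := fun δ u => (1 - Complex.exp (-(δ * s) * u)) / δ) (f := fun u => (u : ℂ) * s)
    (fun u => 2 * ‖s‖ * u) (Eventually.of_forall fun δ =>
      Continuous.aestronglyMeasurable (by fun_prop)) ?_ (hint.const_mul _) ?_
  · rw [integral_mul_const, integral_complex_ofReal] at h
    refine h.congr' ?_
    filter_upwards [self_mem_nhdsWithin] with δ hδ
    rw [integral_div, integral_sub (integrable_const _) (integrable_exp_neg_mul hG (hre hδ))]
    simp [workTransform]
  · filter_upwards [self_mem_nhdsWithin] with δ hδ
    have hδ' : (0 : ℝ) < δ := hδ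
    filter_upwards [hG] with u hu
    have h0 : 0 ≤ ((δ : ℂ) * s * u).re := by
      simpa using mul_nonneg (mul_nonneg hδ'.le hs) hu
    have h1 := norm_exp_neg_sub_one_le h0
    rw [norm_div, norm_sub_rev, neg_mul, Complex.norm_real, Real.norm_of_nonneg hδ'.le,
      div_le_iff₀ hδ']
    refine h1.trans (le_of_eq ?_)
    simp only [norm_mul, Complex.norm_real, Real.norm_of_nonneg hδ'.le, Real.norm_of_nonneg hu]
    ring
  · refine Eventually.of_forall fun u => ?_
    have hd : HasDerivAt (fun δ : ℝ => 1 - Complex.exp (-((δ : ℂ) * s) * u)) (u * s) 0 := by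
      have h1 : HasDerivAt (fun z : ℂ => 1 - Complex.exp (-(z * s) * u)) (u * s) ((0 : ℝ) : ℂ) := by
        have h2 : HasDerivAt (fun z : ℂ => -(z * s) * u) (-(1 * s) * u) ((0 : ℝ) : ℂ) :=
          (((hasDerivAt_id _).mul_const s).neg).mul_const _
        refine (h2.cexp.const_sub 1).congr_deriv ?_
        simp
        ring
      exact h1.comp_ofReal
    have := hd.tendsto_slope_zero_right
    refine this.congr fun δ => ?_
    simp [div_eq_inv_mul]

lemma tendsto_repairWeight_zero_div_eps (hG : ∀ᵐ t ∂G, 0 < t)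
    (hint : Integrable (fun t : ℝ => t) G) {n : ℕ} (hn : 2 ≤ n) {s : ℂ} (hs : 0 ≤ s.re) :
    Tendsto (fun μ => repairWeight G μ 0 ((eps G μ ^ (n - 1) : ℝ) * s) / (eps G μ : ℂ)) atTop
      (𝓝 1) := by
  have hG' : ∀ᵐ t ∂G, 0 ≤ t := hG.mono fun _ h => h.le
  obtain ⟨N, rfl⟩ : ∃ N, n = N + 2 := ⟨n - 2, by omega⟩
  simp only [show N + 2 - 1 = N + 1 by omega]
  -- As `n ≥ 2`, it suffices that `∫ u exp (-μ u) dG(u)` tends to zero.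
  have hI : Tendsto (fun μ => ∫ u, u * Real.exp (-μ * u) ∂G) atTop (𝓝 0) := by
    have h := tendsto_integral_filter_of_dominated_convergence (μ := G) (l := atTop)
      (F := fun μ u => u * Real.exp (-μ * u)) (f := fun _ => 0) (fun u => u)
      (Eventually.of_forall fun μ => Continuous.aestronglyMeasurable (by fun_prop))
      ?_ hint ?_
    · simpa using h
    · filter_upwards [eventually_ge_atTop 0] with μ hμ
      filter_upwards [hG'] with u hu
      rw [norm_mul, Real.norm_of_nonneg hu, Real.norm_of_nonneg (Real.exp_nonneg _)]
      refine mul_le_of_le_one_right hu (Real.exp_le_one_iff.2 ?_)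
      nlinarith
    · filter_upwards [hG] with u hu
      have h1 : Tendsto (fun μ : ℝ => -μ * u) atTop atBot := by
        simpa only [neg_mul, Function.comp_def, id] using
          tendsto_neg_atTop_atBot.comp (tendsto_id.atTop_mul_const hu)
      simpa using (Real.tendsto_exp_atBot.comp h1).const_mul u
  have hbound : Tendsto (fun μ => 2 * ‖s‖ * eps G μ ^ N * ∫ u, u * Real.exp (-μ * u) ∂G) atTop
      (𝓝 (2 * ‖s‖ * 0 ^ N * 0)) := (((tendsto_eps hG).pow N).const_mul _).mul hI
  rw [mul_zero] at hbound
  rw [← tendsto_sub_nhds_zero_iff]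
  refine squeeze_zero_norm' ?_ hbound
  filter_upwards [eventually_ge_atTop 0] with μ hμ
  have hε := eps_pos hG' hμ
  set σ : ℂ := (eps G μ ^ (N + 1) : ℝ) * s with hσ
  have hσre : 0 ≤ σ.re := by
    rw [hσ, Complex.re_ofReal_mul]
    positivity
  have hε' : (eps G μ : ℂ) ≠ 0 := by exact_mod_cast hε.ne'
  have hdiff : repairWeight G μ 0 σ - (eps G μ : ℂ) =
      ∫ u, (Complex.exp (-σ * u) - 1) * (Real.exp (-μ * u) : ℂ) ∂G := by
    have h1 := integrable_exp_mul_poissonWeight hG' 0 hμ hσre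
    have h2 : Integrable (fun u : ℝ => ((Real.exp (-μ * u) : ℝ) : ℂ)) G :=
      (integrable_exp_neg_mul_real hG' hμ).ofReal
    have h3 : ∀ u : ℝ, poissonWeight 0 (μ * u) = Real.exp (-μ * u) := fun u => by
      simp [poissonWeight]
    simp only [h3] at h1
    rw [repairWeight_zero, eps, ← integral_complex_ofReal, ← integral_sub h1 h2]
    simp only [sub_mul, one_mul]
  rw [div_sub_one hε', hdiff, norm_div, Complex.norm_real, Real.norm_of_nonneg hε.le,
    div_le_iff₀ hε]
  refine (norm_integral_le_of_norm_le (g := fun u => 2 * ‖σ‖ * (u * Real.exp (-μ * u))) ?_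
    ?_).trans ?_
  · refine Integrable.const_mul (hint.mono (Continuous.aestronglyMeasurable (by fun_prop)) ?_) _
    filter_upwards [hG'] with u hu
    rw [norm_mul, Real.norm_of_nonneg (Real.exp_nonneg _)]
    refine mul_le_of_le_one_right (norm_nonneg _) (Real.exp_le_one_iff.2 ?_)
    nlinarith
  · filter_upwards [hG'] with u hu
    have h0 : 0 ≤ (σ * u).re := by simpa using mul_nonneg hσre hu
    have h1 := norm_exp_neg_sub_one_le h0
    rw [norm_mul, Complex.norm_real, Real.norm_of_nonneg (Real.exp_nonneg _), ← mul_assoc]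
    refine mul_le_mul_of_nonneg_right ?_ (Real.exp_nonneg _)
    rw [neg_mul]
    refine h1.trans (le_of_eq ?_)
    rw [norm_mul, Complex.norm_real, Real.norm_of_nonneg hu]
    ring
  · rw [integral_const_mul, hσ, norm_mul, Complex.norm_real, Real.norm_of_nonneg (by positivity),
      pow_succ]
    exact le_of_eq (by ring)

/-- The transforms, with parameter scaled by `ε(μ) ^ (n - 1)`, converge to the transform of the
exponential law of mean `b`. -/
theorem tendsto_transform {n j : ℕ} (hn : 2 ≤ n) (hj : j < n) (hG : ∀ᵐ t ∂G, 0 < t)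
    (hint : Integrable (fun t : ℝ => t) G) {s : ℂ} (hs : 0 ≤ s.re) :
    Tendsto (fun μ => transform n j G (expMeasure μ) ((eps G μ ^ (n - 1) : ℝ) * s)) atTop
      (𝓝 (1 / (1 + (∫ t, t ∂G : ℝ) * s))) := by
  have hG' : ∀ᵐ t ∂G, 0 ≤ t := hG.mono fun _ h => h.le
  have hb : 0 ≤ ∫ t, t ∂G := integral_nonneg_of_ae hG'
  have hre : ∀ᶠ μ in atTop, 0 ≤ (((eps G μ ^ (n - 1) : ℝ) : ℂ) * s).re := by
    filter_upwards [eventually_ge_atTop 0] with μ hμ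
    rw [Complex.re_ofReal_mul]
    exact mul_nonneg (pow_nonneg (eps_pos hG' hμ).le _) hs
  have hpos : ∀ᶠ μ in atTop, 0 < eps G μ := by
    filter_upwards [eventually_ge_atTop 0] with μ hμ using eps_pos hG' hμ
  refine tendsto_of_linear_system hn (e := fun μ => (eps G μ : ℂ))
    (g := fun μ => workTransform G ((eps G μ ^ (n - 1) : ℝ) * s))
    (a := fun k μ => repairWeight G μ k ((eps G μ ^ (n - 1) : ℝ) * s))
    (φ := fun i μ => transform n i G (expMeasure μ) ((eps G μ ^ (n - 1) : ℝ) * s))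
    ?_ ?_ ?_ (tendsto_repairWeight_zero_div_eps hG hint hn hs)
    (fun k => tendsto_repairWeight hG (k + 1) hre) ?_ ?_ ?_ ?_ hj
  · intro h
    have h1 := congrArg Complex.re h
    rw [Complex.add_re, Complex.re_ofReal_mul] at h1
    have := mul_nonneg hb hs
    simp at h1
    linarith
  · exact_mod_cast (Complex.continuous_ofReal.tendsto 0).comp (tendsto_eps hG)
  · filter_upwards [hpos] with μ hμ
    exact_mod_cast hμ.ne'
  · have hδ : Tendsto (fun μ => eps G μ ^ (n - 1)) atTop (𝓝[>] 0) := by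
      refine tendsto_nhdsWithin_iff.2 ⟨?_, hpos.mono fun μ hμ => pow_pos hμ _⟩
      simpa [zero_pow (by omega : n - 1 ≠ 0)] using (tendsto_eps hG).pow (n - 1)
    refine ((tendsto_one_sub_workTransform_div hG' hint hs).comp hδ).congr fun μ => ?_
    simp
  · filter_upwards [eventually_gt_atTop 0, hre] with μ hμ h
    have := isProbabilityMeasure_expMeasure hμ
    exact norm_transform_le n 1 h
  · filter_upwards [eventually_gt_atTop 0] with μ hμ
    have := isProbabilityMeasure_expMeasure hμ
    exact transform_self hG' (ae_expMeasure_pos μ) _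
  · intro i hi
    filter_upwards [eventually_gt_atTop 0, hre] with μ hμ h
    exact transform_eq hi hG' hμ h

end Asymptotics

/-! ### Convergence to the exponential law -/

lemma charFun_expMeasure {r : ℝ} (hr : 0 < r) (t : ℝ) :
    charFun (expMeasure r) t = r / (r - t * Complex.I) := by
  have hre : (-(r : ℂ) + t * Complex.I).re < 0 := by simpa using hr
  have hne : (r : ℂ) - t * Complex.I ≠ 0 := fun h => by
    have := congrArg Complex.re h
    simp at this
    exact hr.ne' this
  rw [charFun_apply_real, ← Measure.restrict_eq_self_of_ae_mem (s := Set.Ioi 0)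
    (ae_expMeasure_pos r), setIntegral_expMeasure r _ measurableSet_Ioi]
  have hcongr : ∫ v in Set.Ioi (0 : ℝ), (exponentialPDF r v).toReal •
      Complex.exp (t * v * Complex.I) =
      ∫ v in Set.Ioi (0 : ℝ), (r : ℂ) * Complex.exp ((-(r : ℂ) + t * Complex.I) * v) := by
    refine setIntegral_congr_fun measurableSet_Ioi fun v hv => ?_
    simp only [exponentialPDF_toReal hr (le_of_lt hv), Complex.real_smul]
    push_cast
    rw [mul_assoc, ← Complex.exp_add]
    ring_nf
  have hne' : -(r : ℂ) + t * Complex.I ≠ 0 := fun h => hne (by linear_combination -h)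
  rw [hcongr, integral_const_mul, integral_exp_mul_complex_Ioi hre]
  simp only [Complex.ofReal_zero, mul_zero, Complex.exp_zero]
  field_simp
  ring

lemma expMeasure_real_Ioi {r t : ℝ} (hr : 0 < r) (ht : 0 ≤ t) :
    (expMeasure r).real (Set.Ioi t) = Real.exp (-(r * t)) := by
  have := isProbabilityMeasure_expMeasure hr
  have h := setIntegral_expMeasure_Ioi_comp_sub hr ht fun _ => 1
  simp only [integral_const, probReal_univ, measureReal_restrict_apply_univ, one_smul, mul_one,
    Complex.real_smul] at h
  exact_mod_cast h

/-- Lévy's theorem, with an exponential limit law of mean `b`. -/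
lemma tendsto_tail_of_tendsto_charFun {Ω : ℕ → Type*} [∀ k, MeasurableSpace (Ω k)]
    (P : ∀ k, Measure (Ω k)) [∀ k, IsProbabilityMeasure (P k)] {X : ∀ k, Ω k → ℝ}
    (hX : ∀ k, AEMeasurable (X k) (P k)) {b : ℝ} (hb : 0 < b)
    (h : ∀ t : ℝ, Tendsto (fun k => ∫ ω, Complex.exp (t * X k ω * Complex.I) ∂P k) atTop
      (𝓝 (1 / (1 - b * t * Complex.I)))) {t : ℝ} (ht : 0 ≤ t) :
    Tendsto (fun k => (P k).real {ω | t < X k ω}) atTop (𝓝 (Real.exp (-t / b))) := by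
  have hb' : 0 < b⁻¹ := inv_pos.2 hb
  have := isProbabilityMeasure_expMeasure hb'
  let ρ : ℕ → ProbabilityMeasure ℝ := fun k =>
    ⟨(P k).map (X k), Measure.isProbabilityMeasure_map (hX k)⟩
  let ρ₀ : ProbabilityMeasure ℝ := ⟨expMeasure b⁻¹, this⟩
  have hlim : Tendsto ρ atTop (𝓝 ρ₀) := by
    refine ProbabilityMeasure.tendsto_of_tendsto_charFun fun t => ?_
    have h0 : charFun (ρ₀ : Measure ℝ) t = 1 / (1 - b * t * Complex.I) := by
      have hb0 : (b : ℂ) ≠ 0 := by exact_mod_cast hb.ne'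
      refine (charFun_expMeasure hb' t).trans ?_
      rw [← mul_div_mul_left _ _ hb0, Complex.ofReal_inv, mul_inv_cancel₀ hb0, mul_sub,
        mul_inv_cancel₀ hb0, mul_assoc]
    rw [h0]
    refine (h t).congr fun k => ?_
    change _ = charFun ((P k).map (X k)) t
    rw [charFun_apply_real, integral_map (hX k)
      (Continuous.aestronglyMeasurable (by fun_prop))]
  have hfr : (ρ₀ : Measure ℝ) (frontier (Set.Ioi t)) = 0 := by
    rw [frontier_Ioi]
    exact withDensity_absolutelyContinuous volume (exponentialPDF b⁻¹) Real.volume_singleton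
  have hE := (ENNReal.tendsto_toReal (measure_ne_top _ _)).comp
    (ProbabilityMeasure.tendsto_measure_of_null_frontier_of_tendsto' hlim hfr)
  have hval : ((ρ₀ : Measure ℝ) (Set.Ioi t)).toReal = Real.exp (-t / b) := by
    refine (expMeasure_real_Ioi hb' ht).trans ?_
    congr 1
    field_simp
  rw [hval] at hE
  refine hE.congr fun k => ?_
  change ((P k).map (X k) (Set.Ioi t)).toReal = _
  rw [Measure.map_apply_of_aemeasurable (hX k) measurableSet_Ioi]
  rfl

lemma ae_pos_of_continuous_cdf {G : Measure ℝ} [IsProbabilityMeasure G]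
    (hG_nonneg : ∀ᵐ t ∂G, 0 ≤ t) (hG_cont : Continuous (cdf G)) : ∀ᵐ t ∂G, 0 < t := by
  have h0 : G {0} = 0 := by
    rw [← measure_cdf G, StieltjesFunction.measure_singleton]
    have h : Function.leftLim (cdf G) 0 = cdf G 0 :=
      leftLim_eq_of_tendsto
        (hG_cont.continuousAt.tendsto.mono_left nhdsWithin_le_nhds)
    simp [h]
  have h1 : ∀ᵐ t ∂G, t ≠ 0 := by simpa [ae_iff] using h0
  filter_upwards [hG_nonneg, h1] with t h2 h3 using lt_of_le_of_ne h2 h3.symm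

section Model

variable {G : Measure ℝ} [IsProbabilityMeasure G] {Ω : Type*} [MeasurableSpace Ω] {P : Measure Ω}
  {μ : ℝ} {η ξ : ℕ → Ω → ℝ}

lemma IsRepairModel.aemeasurable_systemLifetime (hμ : 0 < μ) (h : IsRepairModel P G μ η ξ)
    (n j : ℕ) : AEMeasurable (systemLifetime n j η ξ) P := by
  have hτ := (measurable_lifetime n j).comp_aemeasurable (h.hasLaw_pathLaw hμ).aemeasurable
  unfold systemLifetime
  simpa only [Function.comp_def] using hτ

lemma IsRepairModel.integral_discount (hμ : 0 < μ) (h : IsRepairModel P G μ η ξ)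
    (n j : ℕ) (s : ℂ) :
    ∫ ω, discount s (systemLifetime n j η ξ ω) ∂P = transform n j G (expMeasure μ) s := by
  have hlaw := h.hasLaw_pathLaw hμ
  rw [transform, ← hlaw.map_eq, integral_map hlaw.aemeasurable
    (measurable_discount_lifetime n j s).aestronglyMeasurable]
  rfl

lemma IsRepairModel.ae_systemLifetime_lt_top [IsProbabilityMeasure P] (hμ : 0 < μ)
    (h : IsRepairModel P G μ η ξ) (hG : ∀ᵐ t ∂G, 0 ≤ t) {n j : ℕ} (hn : 2 ≤ n) (hj : j < n) :
    ∀ᵐ ω ∂P, systemLifetime n j η ξ ω < ⊤ := by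
  have hτ := h.aemeasurable_systemLifetime hμ n j
  have h1 : ∫ ω, discount 0 (systemLifetime n j η ξ ω) ∂P = 1 := by
    rw [h.integral_discount hμ, transform_zero hn hj hG hμ]
  have hint : Integrable (fun ω => discount 0 (systemLifetime n j η ξ ω)) P :=
    Integrable.of_bound ((measurable_discount 0).comp_aemeasurable hτ).aestronglyMeasurable 1
      (Eventually.of_forall fun _ => norm_discount_le le_rfl _)
  -- The nonnegative variable `1 - discount 0 τ`, the indicator of `τ = ⊤`, has mean zero.
  have h2 : ∫ ω, (1 - (discount 0 (systemLifetime n j η ξ ω)).re) ∂P = 0 := by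
    have hre : ∫ ω, (discount 0 (systemLifetime n j η ξ ω)).re ∂P = 1 := by
      have := integral_re hint
      simp only [RCLike.re_to_complex] at this
      rw [this, h1, Complex.one_re]
    have hint_re : Integrable (fun ω => (discount 0 (systemLifetime n j η ξ ω)).re) P := hint.re
    rw [integral_sub (integrable_const _) hint_re]
    simp [hre]
  have hnn : 0 ≤ᵐ[P] fun ω => 1 - (discount 0 (systemLifetime n j η ξ ω)).re :=
    Eventually.of_forall fun ω => sub_nonneg.2
      ((Complex.re_le_norm _).trans (norm_discount_le le_rfl _))
  have h3 := (integral_eq_zero_iff_of_nonneg_ae hnn ((integrable_const _).sub hint.re)).1 h2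
  filter_upwards [h3] with ω hω
  refine lt_top_iff_ne_top.2 fun htop => ?_
  simp [discount, htop] at hω

lemma IsRepairModel.integral_exp [IsProbabilityMeasure P] (hμ : 0 < μ)
    (h : IsRepairModel P G μ η ξ) (hG : ∀ᵐ t ∂G, 0 ≤ t) {n j : ℕ} (hn : 2 ≤ n) (hj : j < n)
    (s : ℂ) :
    ∫ ω, Complex.exp (-s * ((systemLifetime n j η ξ ω).toReal : ℂ)) ∂P =
      transform n j G (expMeasure μ) s := by
  rw [← h.integral_discount hμ]
  refine integral_congr_ae ?_
  filter_upwards [h.ae_systemLifetime_lt_top hμ hG hn hj] with ω hω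
  rw [discount, if_neg hω.ne]

end Model

end ColdReserve

/-- The random variables are given, for each rate `μ > 0`, on a probability space of their own. -/
theorem mainTheorem1
    (n : ℕ) (hn : 2 ≤ n)
    (G : Measure ℝ) [IsProbabilityMeasure G]
    (hG_nonneg : ∀ᵐ t ∂G, 0 ≤ t)
    (hG_cont : Continuous (cdf G))
    (b : ℝ) (hG_int : Integrable (fun t : ℝ => t) G) (hb : ∫ t, t ∂G = b)
    {Ω : ℝ → Type*} [∀ μ, MeasurableSpace (Ω μ)]
    (P : ∀ μ, Measure (Ω μ)) [∀ μ, IsProbabilityMeasure (P μ)]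
    (η ξ : ∀ μ, ℕ → Ω μ → ℝ)
    (hmodel : ∀ μ, 0 < μ → ColdReserve.IsRepairModel (P μ) G μ (η μ) (ξ μ))
    (j : ℕ) (hj : j < n) :
    (∀ μ, 0 < μ → ∀ᵐ ω ∂(P μ), ColdReserve.systemLifetime n j (η μ) (ξ μ) ω < ⊤) ∧
    (∀ t : ℝ, 0 ≤ t →
      Tendsto
        (fun μ : ℝ => (P μ).real {ω | ENNReal.ofReal t <
          ENNReal.ofReal (ColdReserve.eps G μ ^ (n - 1)) *
            ColdReserve.systemLifetime n j (η μ) (ξ μ) ω})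
        atTop (𝓝 (Real.exp (-t / b)))) ∧
    (∀ s : ℝ, 0 ≤ s →
      Tendsto
        (fun μ : ℝ => ColdReserve.laplaceTransform (P μ)
          (ColdReserve.systemLifetime n j (η μ) (ξ μ)) (ColdReserve.eps G μ ^ (n - 1) * s))
        atTop (𝓝 (1 / (1 + b * s)))) := by
  have hG : ∀ᵐ t ∂G, 0 < t := ColdReserve.ae_pos_of_continuous_cdf hG_nonneg hG_cont
  have hb_pos : 0 < b := by
    rw [← hb, integral_pos_iff_support_of_nonneg_ae hG_nonneg hG_int, pos_iff_ne_zero]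
    intro h0
    have hmem : ∀ᵐ t ∂G, t ∈ Function.support (fun t : ℝ => t) := hG.mono fun t ht => ht.ne'
    have h1 : G Set.univ = 0 := by
      rw [← measure_congr (eventuallyEq_univ.2 hmem)]
      exact h0
    exact one_ne_zero (measure_univ (μ := G) ▸ h1)
  refine ⟨fun μ hμ => (hmodel μ hμ).ae_systemLifetime_lt_top hμ hG_nonneg hn hj,
    fun t ht => ?_, fun s hs => ?_⟩
  · rw [tendsto_iff_seq_tendsto]
    intro u hu
    -- Rates `μ ≤ 0`, for which nothing is assumed, are avoided by truncating the sequence at `1`.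
    set w : ℕ → ℝ := fun k => max (u k) 1 with hw
    have hwpos : ∀ k, 0 < w k := fun k => lt_max_of_lt_right one_pos
    have huw : ∀ᶠ k in atTop, w k = u k :=
      (hu.eventually_ge_atTop 1).mono fun k hk => max_eq_left hk
    have hwlim : Tendsto w atTop atTop := hu.congr' (huw.mono fun k hk => hk.symm)
    have htail := ColdReserve.tendsto_tail_of_tendsto_charFun (fun k => P (w k))
      (X := fun k ω => ColdReserve.eps G (w k) ^ (n - 1) *
        (ColdReserve.systemLifetime n j (η (w k)) (ξ (w k)) ω).toReal)
      (fun k => (((hmodel _ (hwpos k)).aemeasurable_systemLifetime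
        (hwpos k) n j).ennreal_toReal).const_mul _) hb_pos ?_ ht
    · refine htail.congr' ?_
      filter_upwards [huw] with k hk
      rw [Function.comp_apply, ← hk]
      refine measureReal_congr ?_
      filter_upwards [(hmodel _ (hwpos k)).ae_systemLifetime_lt_top (hwpos k) hG_nonneg hn hj]
        with ω hω
      have hε := (ColdReserve.eps_pos hG_nonneg (hwpos k).le).le
      refine propext ?_
      change t < _ ↔ ENNReal.ofReal t < _
      conv_rhs => rw [← ENNReal.ofReal_toReal hω.ne, ← ENNReal.ofReal_mul (pow_nonneg hε _)]
      exact (ENNReal.ofReal_lt_ofReal_iff_of_nonneg ht).symm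
    · intro v
      have h := (ColdReserve.tendsto_transform hn hj hG hG_int
        (s := -(v * Complex.I)) (by simp)).comp hwlim
      rw [hb] at h
      have hlim : (1 : ℂ) / (1 + b * -(v * Complex.I)) = 1 / (1 - b * v * Complex.I) := by
        congr 1; ring
      rw [hlim] at h
      refine h.congr fun k => ?_
      rw [Function.comp_apply,
        ← (hmodel _ (hwpos k)).integral_exp (hwpos k) hG_nonneg hn hj]
      refine integral_congr_ae (Eventually.of_forall fun ω => ?_)
      simp only
      congr 1
      push_cast
      ring
  · have h := (Complex.continuous_re.tendsto _).comp (ColdReserve.tendsto_transform hn hj hG hG_int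
      (s := (s : ℂ)) (by simpa using hs))
    rw [hb] at h
    have hlim : ((1 : ℂ) / (1 + b * s)).re = 1 / (1 + b * s) := by
      rw [← Complex.ofReal_re (1 / (1 + b * s))]
      push_cast
      rfl
    rw [hlim] at h
    refine h.congr' ?_
    filter_upwards [eventually_gt_atTop 0] with μ hμ
    rw [Function.comp_apply, ← (hmodel μ hμ).integral_exp hμ hG_nonneg hn hj,
      ColdReserve.laplaceTransform, ← Complex.ofReal_re (∫ ω, _ ∂P μ), ← integral_complex_ofReal]
    push_cast
    rfl
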